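/- **The language SFPC.** Types are given by $$\tau,\sigma ::= \alpha \mid \mathsf{Real} \mid \mathbf 1 \mid \tau\times\sigma \mid \tau\to\sigma \mid \{\ell_1\,\tau_1 \mid\dots\mid \ell_n\,\tau_n\}\mid \mu\alpha.\tau ,$$ where a variant type is a finite dictionary from labels to types and $\mu\alpha$ binds $\alpha$. Terms are given by $$\begin{aligned} t,s ::={}& x \mid \underline f(t_1,\dots,t_n) \mid \mathsf{ifz}(t;s_1;s_2)\mid \mathsf{sample}\mid \mathsf{score}(t)\mid () \mid (t,s)\mid \tau.\ell\, t\mid \mathsf{roll}_\tau(t)\mid \lambda x{:}\tau.\,t\mid t\,s\\ &\mid \mathsf{match}\ t\ \mathsf{with}\ ()\to s\mid \mathsf{match}\ t\ \mathsf{with}\ (x,y)\to s\mid \mathsf{match}\ t\ \mathsf{with}\ \{\ell_1x_1\to s_1\mid\dots\mid \ell_nx_n\to s_n\}\mid \mathsf{match}\ t\ \mathsf{with}\ \mathsf{roll}\,x\to s\end{aligned}$$ with one primitive $\underline f$ for every Borel-measurable partial function $f:\mathbb R^n\rightharpoonup\mathbb R$ (in particular a constant $\underline r$ for every $r\in\mathbb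 R$). Contexts $\Gamma$ are finite dictionaries from variables to closed types, and $\Gamma\vdash t:\tau$ is the standard simple typing judgement, with $\mathsf{sample}:\mathsf{Real}$, with $\mathsf{score}(t):\mathbf 1$ for $t:\mathsf{Real}$, and with $\mathsf{roll}$ and its match passing between $\sigma[\alpha\mapsto\mu\alpha.\sigma]$ and $\mu\alpha.\sigma$. Write $\mathsf{let}\ x{:}\tau=t\ \mathsf{in}\ s$ for $(\lambda x{:}\tau.\,s)\,t$. Values are $v,w::=x\mid\underline r\mid()\mid(v,w)\mid\tau.\ell\,v\mid\mathsf{roll}_\tau(v)\mid\lambda x{:}\tau.\,t$. **Operational semantics.** Terms carry the $\sigma$-algebra in which a set $A$ is measurable iff, for each term template $s$ with $k$ parameters in place of real constants, $\{r\in\mathbb R^k : s[r]\in A\}$ is Borel. Kernels $\Downarrow_n$ from closed terms to closed values are defined by $t\Downarrow_0\,:=0$ and, for $n>0$, by the usual left-to-right call-by-value big-step rules, read as integration (Kleisli composition of kernels): $\mathsf{sample}\Downarrow_n$ is the law of $\underline r$ for $r$ uniform on $[0,1]$; $\mathsf{score}(t)\Downarrow_n$ evaluates $t\Downarrow_n\underline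 r$ and yields $|r|\cdot\delta_{()}$; $\mathsf{ifz}(t;s_1;s_2)$ evaluates $t\Downarrow_n\underline r$ and continues with $s_1\Downarrow_n$ if $r=0$ and with $s_2\Downarrow_n$ otherwise; a primitive applied outside its domain contributes the zero measure; immediate subterms are evaluated at level $n$, while the substituted bodies in function application and in the matches on pairs, variants and $\mathsf{roll}$ are evaluated at level $n-1$. Put $t\Downarrow\;:=\sup_n (t\Downarrow_n)$. **Contextual equivalence.** A program context $C$ of type $\mathsf{Real}$ with a hole of type $\Gamma\vdash\tau$ is a closed term of type $\mathsf{Real}$ that may use a hole of type $\tau$, any number of times, each time in a variable context extending $\Gamma$; $C[t]$ is the result of substituting $t$ for the hole, with capture of variables. Terms $\Gamma\vdash t,s:\tau$ are *contextually equivalent*, $t\approx s$, if for all such $C$ the measures $C[t]\Downarrow$ and $C[s]\Downarrow$ on the closed values of type $\mathsf{Real}$ are equal (equivalently, each is $\le$ the other). **Corollary (Commutativity).** Let $\Gamma$ be a context and let $x_1\ne x_2$ be variables not in $\Gamma$. For all $\Gamma\vdash t_1:\tau_1$, $\Gamma\vdash t_2:\tau_2$ and $\Gamma,x_1:\tau_1,x_2:\tau_2\vdash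 t_3:\tau_3$, $$\mathsf{let}\ x_1{:}\tau_1=t_1\ \mathsf{in}\ \mathsf{let}\ x_2{:}\tau_2=t_2\ \mathsf{in}\ t_3\quad\approx\quad \mathsf{let}\ x_2{:}\tau_2=t_2\ \mathsf{in}\ \mathsf{let}\ x_1{:}\tau_1=t_1\ \mathsf{in}\ t_3 .$$ -/

import Mathlib

open MeasureTheory
open scoped ENNReal

namespace SFPC

/-! ### Types -/

/-- SFPC types that are well-formed in a type-variable context with `n` variables (de Bruijn
indices, so `α`-equivalent types are equal). `Ty 0` is the set of closed, well-kinded types.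
Constructor labels are natural numbers; a variant type is a dictionary: a finite set of labels
and a type for each of them. -/
inductive Ty : ℕ → Type
  | tvar {n : ℕ} (i : Fin n) : Ty n
  | real {n : ℕ} : Ty n
  | unit {n : ℕ} : Ty n
  | prod {n : ℕ} (σ τ : Ty n) : Ty n
  | func {n : ℕ} (σ τ : Ty n) : Ty n
  | variant {n : ℕ} (L : Finset ℕ) (τ : {l // l ∈ L} → Ty n) : Ty n
  | mu {n : ℕ} (τ : Ty (n + 1)) : Ty n

/-- Renaming of type variables. -/
def Ty.rename : {n m : ℕ} → (Fin n → Fin m) → Ty n → Ty m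
  | _, _, ρ, .tvar i => .tvar (ρ i)
  | _, _, _, .real => .real
  | _, _, _, .unit => .unit
  | _, _, ρ, .prod σ τ => .prod (σ.rename ρ) (τ.rename ρ)
  | _, _, ρ, .func σ τ => .func (σ.rename ρ) (τ.rename ρ)
  | _, _, ρ, .variant L τ => .variant L fun l => (τ l).rename ρ
  | _, _, ρ, .mu τ => .mu (τ.rename (Fin.cases 0 fun i => (ρ i).succ))

/-- Simultaneous capture-avoiding substitution of types for type variables. -/
def Ty.subst : {n m : ℕ} → (Fin n → Ty m) → Ty n → Ty m
  | _, _, θ, .tvar i => θ i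
  | _, _, _, .real => .real
  | _, _, _, .unit => .unit
  | _, _, θ, .prod σ τ => .prod (σ.subst θ) (τ.subst θ)
  | _, _, θ, .func σ τ => .func (σ.subst θ) (τ.subst θ)
  | _, _, θ, .variant L τ => .variant L fun l => (τ l).subst θ
  | _, _, θ, .mu τ => .mu (τ.subst (Fin.cases (.tvar 0) fun i => (θ i).rename Fin.succ))

/-- The unfolding `τ[α ↦ μα.τ]` of the recursive type `μα.τ`. -/
def Ty.unfold (τ : Ty 1) : Ty 0 := τ.subst fun _ => .mu τ

/-! ### Terms -/

/-- Borel-measurable partial functions `ℝⁿ ⇀ ℝ`: preimages of Borel sets are Borel. -/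
structure PrimFn (n : ℕ) where
  toPFun : (Fin n → ℝ) →. ℝ
  measurableSet_preimage : ∀ B : Set ℝ, MeasurableSet B → MeasurableSet (toPFun.preimage B)

/-- Raw SFPC terms with named variables (natural numbers), whose real constants are drawn from
`K`; actual terms have `K = ℝ`, and `K = Fin k` gives term templates with `k` real parameters.
The constructor `hole` is the hole of program contexts; it is untypable in ordinary terms. -/
inductive Tm (K : Type) : Type
  | hole : Tm K
  | var (x : ℕ) : Tm K
  | const (r : K) : Tm K
  | prim (n : ℕ) (f : PrimFn n) (t : Fin n → Tm K) : Tm K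
  | ifz (t s₁ s₂ : Tm K) : Tm K
  | sample : Tm K
  | score (t : Tm K) : Tm K
  | unit : Tm K
  | pair (t s : Tm K) : Tm K
  | inj (τ : Ty 0) (l : ℕ) (t : Tm K) : Tm K
  | roll (τ : Ty 0) (t : Tm K) : Tm K
  | lam (x : ℕ) (τ : Ty 0) (t : Tm K) : Tm K
  | app (t s : Tm K) : Tm K
  /-- `match t with () → s` -/
  | umatch (t s : Tm K) : Tm K
  /-- `match t with (x, y) → s` -/
  | pmatch (t : Tm K) (x y : ℕ) (s : Tm K) : Tm K
  /-- `match t with {l (x l) → s l | l ∈ L}` -/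
  | vmatch (t : Tm K) (L : Finset ℕ) (x : {l // l ∈ L} → ℕ) (s : {l // l ∈ L} → Tm K) : Tm K
  /-- `match t with roll x → s` -/
  | rmatch (t : Tm K) (x : ℕ) (s : Tm K) : Tm K

/-- `let x : τ = t in s`, i.e. `(λ x : τ. s) t`. -/
def Tm.letIn {K : Type} (x : ℕ) (τ : Ty 0) (t s : Tm K) : Tm K := .app (.lam x τ s) t

/-- Replace the real constants of a term along a function. -/
def Tm.map {K K' : Type} (g : K → K') : Tm K → Tm K'
  | .hole => .hole
  | .var x => .var x
  | .const r => .const (g r)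
  | .prim n f t => .prim n f fun i => (t i).map g
  | .ifz t s₁ s₂ => .ifz (t.map g) (s₁.map g) (s₂.map g)
  | .sample => .sample
  | .score t => .score (t.map g)
  | .unit => .unit
  | .pair t s => .pair (t.map g) (s.map g)
  | .inj τ l t => .inj τ l (t.map g)
  | .roll τ t => .roll τ (t.map g)
  | .lam x τ t => .lam x τ (t.map g)
  | .app t s => .app (t.map g) (s.map g)
  | .umatch t s => .umatch (t.map g) (s.map g)
  | .pmatch t x y s => .pmatch (t.map g) x y (s.map g)
  | .vmatch t L x s => .vmatch (t.map g) L x fun l => (s l).map g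
  | .rmatch t x s => .rmatch (t.map g) x (s.map g)

/-- Capturing substitution `C[t]` of `t` for every occurrence of the hole of `C`. -/
def Tm.plug {K : Type} : Tm K → Tm K → Tm K
  | .hole, t => t
  | .var x, _ => .var x
  | .const r, _ => .const r
  | .prim n f s, t => .prim n f fun i => (s i).plug t
  | .ifz s s₁ s₂, t => .ifz (s.plug t) (s₁.plug t) (s₂.plug t)
  | .sample, _ => .sample
  | .score s, t => .score (s.plug t)
  | .unit, _ => .unit
  | .pair s s', t => .pair (s.plug t) (s'.plug t)
  | .inj τ l s, t => .inj τ l (s.plug t)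
  | .roll τ s, t => .roll τ (s.plug t)
  | .lam x τ s, t => .lam x τ (s.plug t)
  | .app s s', t => .app (s.plug t) (s'.plug t)
  | .umatch s s', t => .umatch (s.plug t) (s'.plug t)
  | .pmatch s x y s', t => .pmatch (s.plug t) x y (s'.plug t)
  | .vmatch s L x s', t => .vmatch (s.plug t) L x fun l => (s' l).plug t
  | .rmatch s x s', t => .rmatch (s.plug t) x (s'.plug t)

/-- Simultaneous substitution of the terms `θ x` for the free variables `x` on which `θ` is
defined. The operational semantics only substitutes closed values, so no binder has to be
renamed to avoid capture. -/
def Tm.subst {K : Type} : (ℕ → Option (Tm K)) → Tm K → Tm K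
  | _, .hole => .hole
  | θ, .var x => (θ x).getD (.var x)
  | _, .const r => .const r
  | θ, .prim n f t => .prim n f fun i => (t i).subst θ
  | θ, .ifz t s₁ s₂ => .ifz (t.subst θ) (s₁.subst θ) (s₂.subst θ)
  | _, .sample => .sample
  | θ, .score t => .score (t.subst θ)
  | _, .unit => .unit
  | θ, .pair t s => .pair (t.subst θ) (s.subst θ)
  | θ, .inj τ l t => .inj τ l (t.subst θ)
  | θ, .roll τ t => .roll τ (t.subst θ)
  | θ, .lam x τ t => .lam x τ (t.subst (Function.update θ x none))
  | θ, .app t s => .app (t.subst θ) (s.subst θ)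
  | θ, .umatch t s => .umatch (t.subst θ) (s.subst θ)
  | θ, .pmatch t x y s =>
      .pmatch (t.subst θ) x y (s.subst (Function.update (Function.update θ x none) y none))
  | θ, .vmatch t L x s =>
      .vmatch (t.subst θ) L x fun l => (s l).subst (Function.update θ (x l) none)
  | θ, .rmatch t x s => .rmatch (t.subst θ) x (s.subst (Function.update θ x none))

/-- `t[x ↦ v]` -/
def Tm.subst₁ {K : Type} (t : Tm K) (x : ℕ) (v : Tm K) : Tm K :=
  t.subst (Function.update (fun _ => none) x (some v))

/-- `t[x ↦ v, y ↦ w]` -/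
def Tm.subst₂ {K : Type} (t : Tm K) (x : ℕ) (v : Tm K) (y : ℕ) (w : Tm K) : Tm K :=
  t.subst (Function.update (Function.update (fun _ => none) x (some v)) y (some w))

/-! ### Type system -/

/-- Variable contexts: partial functions from variables to closed types (finiteness of the domain
is not needed anywhere and not imposed). -/
abbrev Ctx : Type := ℕ → Option (Ty 0)

/-- The empty variable context. -/
def Ctx.empty : Ctx := fun _ => none

/-- `Γ, x : τ` -/
def Ctx.extend (Γ : Ctx) (x : ℕ) (τ : Ty 0) : Ctx := Function.update Γ x (some τ)

/-- `Γ.Le Γ'`: the context `Γ'` extends `Γ`. -/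
def Ctx.Le (Γ Γ' : Ctx) : Prop := ∀ x τ, Γ x = some τ → Γ' x = some τ

/-- The typing judgement. With `H = none` it is the judgement `Γ ⊢ t : τ` for terms. With
`H = some (Γ₀, τ₀)` it is the judgement for program contexts with a hole of type `Γ₀ ⊢ τ₀`,
which may occur any number of times, each time in a variable context extending `Γ₀`. -/
inductive HasType {K : Type} (H : Option (Ctx × Ty 0)) : Ctx → Tm K → Ty 0 → Prop
  | hole {Γ Γ₀ : Ctx} {τ₀ : Ty 0} : H = some (Γ₀, τ₀) → Γ₀.Le Γ → HasType H Γ .hole τ₀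
  | var {Γ : Ctx} {x : ℕ} {τ : Ty 0} : Γ x = some τ → HasType H Γ (.var x) τ
  | const {Γ : Ctx} (r : K) : HasType H Γ (.const r) .real
  | prim {Γ : Ctx} {n : ℕ} (f : PrimFn n) {t : Fin n → Tm K} :
      (∀ i, HasType H Γ (t i) .real) → HasType H Γ (.prim n f t) .real
  | ifz {Γ : Ctx} {t s₁ s₂ : Tm K} {τ : Ty 0} :
      HasType H Γ t .real → HasType H Γ s₁ τ → HasType H Γ s₂ τ → HasType H Γ (.ifz t s₁ s₂) τ
  | sample {Γ : Ctx} : HasType H Γ .sample .real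
  | score {Γ : Ctx} {t : Tm K} : HasType H Γ t .real → HasType H Γ (.score t) .unit
  | unit {Γ : Ctx} : HasType H Γ .unit .unit
  | pair {Γ : Ctx} {t s : Tm K} {σ τ : Ty 0} :
      HasType H Γ t σ → HasType H Γ s τ → HasType H Γ (.pair t s) (.prod σ τ)
  | inj {Γ : Ctx} {L : Finset ℕ} {τ : {l // l ∈ L} → Ty 0} (l : {l // l ∈ L}) {t : Tm K} :
      HasType H Γ t (τ l) → HasType H Γ (.inj (.variant L τ) l t) (.variant L τ)
  | roll {Γ : Ctx} {τ : Ty 1} {t : Tm K} :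
      HasType H Γ t τ.unfold → HasType H Γ (.roll (.mu τ) t) (.mu τ)
  | lam {Γ : Ctx} {x : ℕ} {σ τ : Ty 0} {t : Tm K} :
      HasType H (Γ.extend x σ) t τ → HasType H Γ (.lam x σ t) (.func σ τ)
  | app {Γ : Ctx} {t s : Tm K} {σ τ : Ty 0} :
      HasType H Γ t (.func σ τ) → HasType H Γ s σ → HasType H Γ (.app t s) τ
  | umatch {Γ : Ctx} {t s : Tm K} {τ : Ty 0} :
      HasType H Γ t .unit → HasType H Γ s τ → HasType H Γ (.umatch t s) τ
  | pmatch {Γ : Ctx} {t s : Tm K} {x y : ℕ} {σ ρ τ : Ty 0} :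
      x ≠ y → HasType H Γ t (.prod σ ρ) → HasType H ((Γ.extend x σ).extend y ρ) s τ →
      HasType H Γ (.pmatch t x y s) τ
  | vmatch {Γ : Ctx} {t : Tm K} {L : Finset ℕ} {σ : {l // l ∈ L} → Ty 0}
      {x : {l // l ∈ L} → ℕ} {s : {l // l ∈ L} → Tm K} {τ : Ty 0} :
      HasType H Γ t (.variant L σ) → (∀ l, HasType H (Γ.extend (x l) (σ l)) (s l) τ) →
      HasType H Γ (.vmatch t L x s) τ
  | rmatch {Γ : Ctx} {t s : Tm K} {x : ℕ} {σ : Ty 1} {τ : Ty 0} :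
      HasType H Γ t (.mu σ) → HasType H (Γ.extend x σ.unfold) s τ →
      HasType H Γ (.rmatch t x s) τ

/-- Values. -/
inductive IsValue {K : Type} : Tm K → Prop
  | var (x : ℕ) : IsValue (.var x)
  | const (r : K) : IsValue (.const r)
  | unit : IsValue .unit
  | pair {v w : Tm K} : IsValue v → IsValue w → IsValue (.pair v w)
  | inj {τ : Ty 0} {l : ℕ} {v : Tm K} : IsValue v → IsValue (.inj τ l v)
  | roll {τ : Ty 0} {v : Tm K} : IsValue v → IsValue (.roll τ v)
  | lam (x : ℕ) (τ : Ty 0) (t : Tm K) : IsValue (.lam x τ t)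

/-- The set of terms `Γ ⊢ t : τ`. -/
def Expr (Γ : Ctx) (τ : Ty 0) : Set (Tm ℝ) := {t | HasType none Γ t τ}

/-- The set of values `Γ ⊢ v : τ`. -/
def Val (Γ : Ctx) (τ : Ty 0) : Set (Tm ℝ) := {v | IsValue v ∧ HasType none Γ v τ}

/-! ### Operational semantics -/

/-- The measurable structure on terms: a set `A` of terms is measurable iff for every template
`s` with `k` real parameters, the set of all `r ∈ ℝᵏ` with `s[r] ∈ A` is Borel. Every template is
obtained from one that uses its parameters linearly and in order by precomposition with a
coordinate map, so this is the coproduct `σ`-algebra on `∑ ℝᵏ`, the sum being over all `k` and all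
linear templates with `k` parameters. -/
instance : MeasurableSpace (Tm ℝ) :=
  ⨅ (k : ℕ) (s : Tm (Fin k)),
    MeasurableSpace.map (fun r : Fin k → ℝ => s.map r) MeasurableSpace.pi

noncomputable section

open Classical in
/-- The value of a partial primitive; the zero measure where it is undefined. -/
def PrimFn.eval {n : ℕ} (f : PrimFn n) (r : Fin n → ℝ) : Measure (Tm ℝ) :=
  if h : (f.toPFun r).Dom then Measure.dirac (.const ((f.toPFun r).get h)) else 0

/-- The continuation that expects a real constant as the result of an evaluation. -/
def onReal {X : Type} [MeasurableSpace X] (k : ℝ → Measure X) : Tm ℝ → Measure X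
  | .const r => k r
  | _ => 0

/-- Sequential (left-to-right) composition of real-valued evaluations. -/
def evalArgs : (n : ℕ) → (Fin n → Measure (Tm ℝ)) → Measure (Fin n → ℝ)
  | 0, _ => Measure.dirac Fin.elim0
  | n + 1, μ => (μ 0).bind <| onReal fun r =>
      (evalArgs n fun i => μ i.succ).bind fun rs => Measure.dirac (Fin.cons r rs)

/-- One level of the big-step semantics, by structural recursion; `next` is the semantics at the
previous level, to which substituted terms are passed. -/
def evalStep (next : Tm ℝ → Measure (Tm ℝ)) : Tm ℝ → Measure (Tm ℝ)
  | .hole => 0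
  | .var _ => 0
  | .const r => Measure.dirac (.const r)
  | .prim n f t => (evalArgs n fun i => evalStep next (t i)).bind f.eval
  | .ifz t s₁ s₂ => (evalStep next t).bind <| onReal fun r =>
      if r = 0 then evalStep next s₁ else evalStep next s₂
  | .sample => (volume.restrict (Set.Icc (0 : ℝ) 1)).bind fun r => Measure.dirac (.const r)
  | .score t => (evalStep next t).bind <| onReal fun r =>
      ENNReal.ofReal |r| • Measure.dirac .unit
  | .unit => Measure.dirac .unit
  | .pair t s => (evalStep next t).bind fun v => (evalStep next s).bind fun w =>
      Measure.dirac (.pair v w)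
  | .inj τ l t => (evalStep next t).bind fun v => Measure.dirac (.inj τ l v)
  | .roll τ t => (evalStep next t).bind fun v => Measure.dirac (.roll τ v)
  | .lam x τ t => Measure.dirac (.lam x τ t)
  | .app t s => (evalStep next t).bind fun u => match u with
      | .lam x _ b => (evalStep next s).bind fun w => next (b.subst₁ x w)
      | _ => 0
  | .umatch t s => (evalStep next t).bind fun u => match u with
      | .unit => evalStep next s
      | _ => 0
  | .pmatch t x y s => (evalStep next t).bind fun u => match u with
      | .pair v w => next (s.subst₂ x v y w)
      | _ => 0
  | .vmatch t L x s => (evalStep next t).bind fun u => match u with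
      | .inj _ l v => if h : l ∈ L then next ((s ⟨l, h⟩).subst₁ (x ⟨l, h⟩) v) else 0
      | _ => 0
  | .rmatch t x s => (evalStep next t).bind fun u => match u with
      | .roll _ v => next (s.subst₁ x v)
      | _ => 0

/-- The indexed evaluation kernels `t ⇓ₙ`, concentrated on values. All the functions bound in
`evalStep (evalN n)` are measurable, so that `Measure.bind` is Kleisli composition of kernels. -/
def evalN : ℕ → Tm ℝ → Measure (Tm ℝ)
  | 0 => fun _ => 0
  | n + 1 => evalStep (evalN n)

/-- The evaluation kernel `t ⇓`, the least upper bound of the increasing sequence `t ⇓ₙ`. -/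
def eval (t : Tm ℝ) : Measure (Tm ℝ) := ⨆ n, evalN n t

end

/-! ### Contextual equivalence -/

/-- The contextual preorder on `Expr Γ τ`: in all program contexts of type `Real` with hole
`Γ ⊢ τ`, the resulting closed programs have comparable evaluation measures on the closed values
of type `Real`. -/
def CtxPreorder (Γ : Ctx) (τ : Ty 0) (t s : Tm ℝ) : Prop :=
  t ∈ Expr Γ τ ∧ s ∈ Expr Γ τ ∧
    ∀ C : Tm ℝ, HasType (some (Γ, τ)) Ctx.empty C .real →
      ∀ A : Set (Tm ℝ), MeasurableSet A → A ⊆ Val Ctx.empty .real →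
        eval (C.plug t) A ≤ eval (C.plug s) A

/-- Contextual equivalence. -/
def CtxEquiv (Γ : Ctx) (τ : Ty 0) (t s : Tm ℝ) : Prop :=
  CtxPreorder Γ τ t s ∧ CtxPreorder Γ τ s t

end SFPC

/-! Semantically the two programs differ only in the order of two iterated integrals, so the heart
of the matter is Tonelli's theorem for evaluation kernels; the rest carries this exchange through
arbitrary program contexts.

Integration. No s-finiteness of `eval t` is proved, and no product σ-algebra on pairs of terms is
used. Measurability is tested along plots: families of terms with one fixed template and measurably
varying constants. A kernel is `Nice` if integrating against it a function that is jointly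
measurable along plots leaves a measurable function of the parameter. Evaluation is nice
(`niceMap_evalStep`, `niceMap_eval`), and it is a fixed point of its one-step functional by
continuity (`eval_eq_evalStep`). The property `CommuteMeas`, that two measures may be interchanged
in iterated integrals, is preserved by Dirac measures, scaling, Kleisli composition and increasing
limits. `sample` is the only source of randomness, so everything reduces to the uniform law
commuting with itself (`CommuteMeas.eval`).

Contexts. `SwapRel` is the syntactic congruence generated, in one direction, by exchanging adjacent
independent bindings. It is stable under substitution (`SwapRel.subst`), and plugging the two sides
into a context gives related programs (`HasType.swapRel_plug`). The simulation `SwapRel.lift_evalN`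
shows that each approximation `evalN n t` is dominated, on test functions respecting the relation,
by the full evaluation of a related `t'`. Only the left program carries an index, so the exchange on
the right happens for full evaluations and costs no fuel. At type `Real` related values are equal,
which gives the contextual preorder; interchanging the roles of the two bindings gives its converse.
-/

namespace SFPC

/-! ### Measurable families of terms -/

/-- Families of terms that share one template and whose real constants depend measurably on the
parameter. -/
inductive TermFamily {X : Type} [MeasurableSpace X] : (X → Tm ℝ) → Prop
  | hole : TermFamily fun _ => .hole
  | var (z : ℕ) : TermFamily fun _ => .var z
  | const {r : X → ℝ} : Measurable r → TermFamily fun x => .const (r x)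
  | prim (n : ℕ) (f : PrimFn n) {t : Fin n → X → Tm ℝ} :
      (∀ i, TermFamily (t i)) → TermFamily fun x => .prim n f fun i => t i x
  | ifz {t s₁ s₂ : X → Tm ℝ} : TermFamily t → TermFamily s₁ → TermFamily s₂ →
      TermFamily fun x => .ifz (t x) (s₁ x) (s₂ x)
  | sample : TermFamily fun _ => .sample
  | score {t : X → Tm ℝ} : TermFamily t → TermFamily fun x => .score (t x)
  | unit : TermFamily fun _ => .unit
  | pair {t s : X → Tm ℝ} : TermFamily t → TermFamily s → TermFamily fun x => .pair (t x) (s x)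
  | inj (τ : Ty 0) (l : ℕ) {t : X → Tm ℝ} : TermFamily t → TermFamily fun x => .inj τ l (t x)
  | roll (τ : Ty 0) {t : X → Tm ℝ} : TermFamily t → TermFamily fun x => .roll τ (t x)
  | lam (z : ℕ) (τ : Ty 0) {t : X → Tm ℝ} : TermFamily t → TermFamily fun x => .lam z τ (t x)
  | app {t s : X → Tm ℝ} : TermFamily t → TermFamily s → TermFamily fun x => .app (t x) (s x)
  | umatch {t s : X → Tm ℝ} : TermFamily t → TermFamily s →
      TermFamily fun x => .umatch (t x) (s x)
  | pmatch (y z : ℕ) {t s : X → Tm ℝ} : TermFamily t → TermFamily s →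
      TermFamily fun x => .pmatch (t x) y z (s x)
  | vmatch (L : Finset ℕ) (z : {l // l ∈ L} → ℕ) {t : X → Tm ℝ} {s : {l // l ∈ L} → X → Tm ℝ} :
      TermFamily t → (∀ l, TermFamily (s l)) →
      TermFamily fun x => .vmatch (t x) L z fun l => s l x
  | rmatch (z : ℕ) {t s : X → Tm ℝ} : TermFamily t → TermFamily s →
      TermFamily fun x => .rmatch (t x) z (s x)

theorem Tm.map_map {K K' K'' : Type} (g : K → K') (h : K' → K'') (t : Tm K) :
    (t.map g).map h = t.map (h ∘ g) := by
  induction t <;> simp_all [Tm.map]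

namespace TermFamily

variable {X Y : Type} [MeasurableSpace X] [MeasurableSpace Y]

theorem comp {f : X → Tm ℝ} (hf : TermFamily f) {a : Y → X} (ha : Measurable a) :
    TermFamily fun y => f (a y) := by
  induction hf with
  | hole => exact .hole
  | var z => exact .var z
  | const hr => exact .const (hr.comp ha)
  | prim n f _ ih => exact .prim n f ih
  | ifz _ _ _ ih₁ ih₂ ih₃ => exact .ifz ih₁ ih₂ ih₃
  | sample => exact .sample
  | score _ ih => exact .score ih
  | unit => exact .unit
  | pair _ _ ih₁ ih₂ => exact .pair ih₁ ih₂
  | inj τ l _ ih => exact .inj τ l ih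
  | roll τ _ ih => exact .roll τ ih
  | lam z τ _ ih => exact .lam z τ ih
  | app _ _ ih₁ ih₂ => exact .app ih₁ ih₂
  | umatch _ _ ih₁ ih₂ => exact .umatch ih₁ ih₂
  | pmatch y z _ _ ih₁ ih₂ => exact .pmatch y z ih₁ ih₂
  | vmatch L z _ _ ih₁ ih₂ => exact .vmatch L z ih₁ ih₂
  | rmatch z _ _ ih₁ ih₂ => exact .rmatch z ih₁ ih₂

theorem map_template {K : Type} (s : Tm K) {g : X → K → ℝ} (hg : Measurable g) :
    TermFamily fun x => s.map (g x) := by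
  induction s with
  | hole => exact .hole
  | var z => exact .var z
  | const r => exact .const ((measurable_pi_apply r).comp hg)
  | prim n f _ ih => exact .prim n f ih
  | ifz _ _ _ ih₁ ih₂ ih₃ => exact .ifz ih₁ ih₂ ih₃
  | sample => exact .sample
  | score _ ih => exact .score ih
  | unit => exact .unit
  | pair _ _ ih₁ ih₂ => exact .pair ih₁ ih₂
  | inj τ l _ ih => exact .inj τ l ih
  | roll τ _ ih => exact .roll τ ih
  | lam z τ _ ih => exact .lam z τ ih
  | app _ _ ih₁ ih₂ => exact .app ih₁ ih₂
  | umatch _ _ ih₁ ih₂ => exact .umatch ih₁ ih₂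
  | pmatch _ y z _ ih₁ ih₂ => exact .pmatch y z ih₁ ih₂
  | vmatch _ L z _ ih₁ ih₂ => exact .vmatch L z ih₁ ih₂
  | rmatch _ z _ ih₁ ih₂ => exact .rmatch z ih₁ ih₂

/-- A term is a template over its own real constants, with the identity as valuation. -/
theorem constant (t : Tm ℝ) : TermFamily fun _ : X => t := by
  have h := map_template (X := X) t (g := fun _ => id) measurable_const
  have : ∀ t : Tm ℝ, t.map id = t := fun t => by
    induction t <;> simp_all [Tm.map]
  simpa only [this] using h

/-- A family factors through a template with finitely many parameters. -/
def Factors (f : X → Tm ℝ) : Prop :=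
  ∃ (K : Type) (_ : Finite K) (s : Tm K) (g : X → K → ℝ), Measurable g ∧ ∀ x, f x = s.map (g x)

theorem Factors.of_constant (s : Tm Empty) {f : X → Tm ℝ} (h : ∀ x, f x = s.map Empty.elim) :
    Factors f :=
  ⟨Empty, inferInstance, s, fun _ => Empty.elim, measurable_const, h⟩

theorem Factors.of_map {f f' : X → Tm ℝ} (hf : Factors f) (c : ∀ {K : Type}, Tm K → Tm K)
    (hc : ∀ {K K' : Type} (g : K → K') (s : Tm K), (c s).map g = c (s.map g))
    (h : ∀ x, f' x = c (f x)) : Factors f' := by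
  obtain ⟨K, _, s, g, hg, e⟩ := hf
  exact ⟨K, inferInstance, c s, g, hg, fun x => by rw [h, e, hc]⟩

theorem Factors.of_map₂ {f₁ f₂ f' : X → Tm ℝ} (h₁ : Factors f₁) (h₂ : Factors f₂)
    (c : ∀ {K : Type}, Tm K → Tm K → Tm K)
    (hc : ∀ {K K' : Type} (g : K → K') (s t : Tm K), (c s t).map g = c (s.map g) (t.map g))
    (h : ∀ x, f' x = c (f₁ x) (f₂ x)) : Factors f' := by
  obtain ⟨K₁, _, s₁, g₁, hg₁, e₁⟩ := h₁
  obtain ⟨K₂, _, s₂, g₂, hg₂, e₂⟩ := h₂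
  refine ⟨K₁ ⊕ K₂, inferInstance, c (s₁.map .inl) (s₂.map .inr),
    fun x => Sum.elim (g₁ x) (g₂ x), ?_, fun x => ?_⟩
  · refine measurable_pi_iff.2 ?_
    rintro (k | k)
    · exact (measurable_pi_apply k).comp hg₁
    · exact (measurable_pi_apply k).comp hg₂
  · rw [h, e₁, e₂, hc, Tm.map_map, Tm.map_map]; rfl

/-- A finite dictionary of families factors through a common set of parameters. -/
theorem Factors.exists_common {ι : Type} [Finite ι] {f : ι → X → Tm ℝ}
    (h : ∀ i, Factors (f i)) :
    ∃ (K : Type) (_ : Finite K) (s : ι → Tm K) (g : X → K → ℝ), Measurable g ∧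
      ∀ i x, f i x = (s i).map (g x) := by
  choose K hK s g hg e using h
  refine ⟨Σ i, K i, inferInstance, fun i => (s i).map (Sigma.mk i), fun x p => g p.1 x p.2, ?_,
    fun i x => ?_⟩
  · exact measurable_pi_iff.2 fun p => (measurable_pi_apply p.2).comp (hg p.1)
  · rw [e, Tm.map_map]; rfl

/-- The σ-algebra on terms only sees templates with finitely many parameters. Subterms receive
disjoint parameter sets, and since terms branch finitely their union stays finite. -/
theorem factors {f : X → Tm ℝ} (hf : TermFamily f) : Factors f := by
  induction hf with
  | hole => exact .of_constant .hole fun _ => rfl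
  | var z => exact .of_constant (.var z) fun _ => rfl
  | @const r hr =>
    exact ⟨Unit, inferInstance, .const (), fun x _ => r x, measurable_pi_iff.2 fun _ => hr,
      fun _ => rfl⟩
  | prim n f _ ih =>
    obtain ⟨K, _, s, g, hg, e⟩ := Factors.exists_common ih
    exact ⟨K, inferInstance, .prim n f s, g, hg, fun x => by simp [Tm.map, e]⟩
  | @ifz t s₁ s₂ _ _ _ ih₁ ih₂ ih₃ =>
    obtain ⟨K, _, s, g, hg, e⟩ := Factors.exists_common (ι := Fin 3) (f := ![t, s₁, s₂])
      (by intro i; fin_cases i <;> assumption)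
    refine ⟨K, inferInstance, .ifz (s 0) (s 1) (s 2), g, hg, fun x => ?_⟩
    rw [Tm.map, ← e, ← e, ← e]; rfl
  | sample => exact .of_constant .sample fun _ => rfl
  | score _ ih => exact ih.of_map .score (fun _ _ => rfl) fun _ => rfl
  | unit => exact .of_constant .unit fun _ => rfl
  | pair _ _ ih₁ ih₂ => exact ih₁.of_map₂ ih₂ .pair (fun _ _ _ => rfl) fun _ => rfl
  | inj τ l _ ih => exact ih.of_map (.inj τ l) (fun _ _ => rfl) fun _ => rfl
  | roll τ _ ih => exact ih.of_map (.roll τ) (fun _ _ => rfl) fun _ => rfl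
  | lam z τ _ ih => exact ih.of_map (.lam z τ) (fun _ _ => rfl) fun _ => rfl
  | app _ _ ih₁ ih₂ => exact ih₁.of_map₂ ih₂ .app (fun _ _ _ => rfl) fun _ => rfl
  | umatch _ _ ih₁ ih₂ => exact ih₁.of_map₂ ih₂ .umatch (fun _ _ _ => rfl) fun _ => rfl
  | pmatch y z _ _ ih₁ ih₂ =>
    exact ih₁.of_map₂ ih₂ (fun t s => .pmatch t y z s) (fun _ _ _ => rfl) fun _ => rfl
  | @vmatch L z t s _ _ ih₁ ih₂ =>
    -- The index `none` stands for the scrutinee and `some l` for the branch at label `l`.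
    obtain ⟨K, _, s', g, hg, e⟩ := Factors.exists_common (ι := Option {l // l ∈ L})
      (f := fun o => o.elim t s) (by rintro (_ | l); exacts [ih₁, ih₂ l])
    refine ⟨K, inferInstance, .vmatch (s' none) L z fun l => s' (some l), g, hg, fun x => ?_⟩
    simp only [Tm.map, ← e]; rfl
  | rmatch z _ _ ih₁ ih₂ =>
    exact ih₁.of_map₂ ih₂ (fun t s => .rmatch t z s) (fun _ _ _ => rfl) fun _ => rfl

theorem measurable_iff {W : Type} [MeasurableSpace W] {g : Tm ℝ → W} :
    Measurable g ↔ ∀ (k : ℕ) (s : Tm (Fin k)), Measurable fun r : Fin k → ℝ => g (s.map r) := by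
  refine ⟨fun hg k s A hA => ?_, fun h A hA => ?_⟩
  · exact (MeasurableSpace.measurableSet_iInf.1
      (MeasurableSpace.measurableSet_iInf.1 (hg hA) k) s)
  · exact MeasurableSpace.measurableSet_iInf.2 fun k =>
      MeasurableSpace.measurableSet_iInf.2 fun s => h k s hA

theorem measurable {f : X → Tm ℝ} (hf : TermFamily f) : Measurable f := by
  obtain ⟨K, _, s, g, hg, e⟩ := hf.factors
  obtain ⟨k, ⟨φ⟩⟩ := Finite.exists_equiv_fin K
  have h := (measurable_iff.1 measurable_id k (s.map φ)).comp
    (measurable_pi_iff.2 fun j => (measurable_pi_apply (φ.symm j)).comp hg :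
      Measurable fun x (j : Fin k) => g x (φ.symm j))
  convert h using 1
  funext x
  rw [e]
  simp only [Function.comp_apply, id, Tm.map_map]
  congr 1
  funext k
  simp

/-- The set of variables on which `θ` is defined does not depend on the parameter, so substitution
happens at the level of templates. -/
theorem subst {f : X → Tm ℝ} (hf : TermFamily f) {θ : ℕ → Option (X → Tm ℝ)}
    (hθ : ∀ z g, θ z = some g → TermFamily g) :
    TermFamily fun x => (f x).subst fun z => (θ z).map fun g => g x := by
  have upd : ∀ (θ : ℕ → Option (X → Tm ℝ)) (z : ℕ) (x : X),
      Function.update (fun z => (θ z).map fun g => g x) z none =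
        fun y => (Function.update θ z none y).map fun g => g x := by
    intro θ z x
    funext y
    by_cases h : y = z
    · subst h; simp
    · simp [Function.update_of_ne h]
  have hupd : ∀ {θ : ℕ → Option (X → Tm ℝ)}, (∀ z g, θ z = some g → TermFamily g) →
      ∀ y, ∀ z g, Function.update θ y none z = some g → TermFamily g := by
    intro θ hθ y z g h
    by_cases e : z = y
    · subst e; simp at h
    · rw [Function.update_of_ne e] at h
      exact hθ z g h
  induction hf generalizing θ with
  | hole => exact .hole
  | var z =>
    simp only [Tm.subst]
    cases h : θ z with
    | none => exact .var z
    | some g => exact hθ z g h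
  | const hr => exact .const hr
  | prim n f _ ih => exact .prim n f fun i => ih i hθ
  | ifz _ _ _ ih₁ ih₂ ih₃ => exact .ifz (ih₁ hθ) (ih₂ hθ) (ih₃ hθ)
  | sample => exact .sample
  | score _ ih => exact .score (ih hθ)
  | unit => exact .unit
  | pair _ _ ih₁ ih₂ => exact .pair (ih₁ hθ) (ih₂ hθ)
  | inj τ l _ ih => exact .inj τ l (ih hθ)
  | roll τ _ ih => exact .roll τ (ih hθ)
  | lam z τ _ ih => simpa only [Tm.subst, upd] using TermFamily.lam z τ (ih (hupd hθ z))
  | app _ _ ih₁ ih₂ => exact .app (ih₁ hθ) (ih₂ hθ)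
  | umatch _ _ ih₁ ih₂ => exact .umatch (ih₁ hθ) (ih₂ hθ)
  | pmatch y z _ _ ih₁ ih₂ =>
    simpa only [Tm.subst, upd] using
      TermFamily.pmatch y z (ih₁ hθ) (ih₂ (hupd (hupd hθ y) z))
  | vmatch L z _ _ ih₁ ih₂ =>
    simpa only [Tm.subst, upd] using
      TermFamily.vmatch L z (ih₁ hθ) fun l => ih₂ l (hupd hθ (z l))
  | rmatch z _ _ ih₁ ih₂ =>
    simpa only [Tm.subst, upd] using TermFamily.rmatch z (ih₁ hθ) (ih₂ (hupd hθ z))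

theorem subst₂ {f g h : X → Tm ℝ} (hf : TermFamily f) (y : ℕ) (hg : TermFamily g) (z : ℕ)
    (hh : TermFamily h) : TermFamily fun x => (f x).subst₂ y (g x) z (h x) := by
  have key := hf.subst
    (θ := Function.update (Function.update (fun _ => none) y (some g)) z (some h))
    (by
      intro w k hk
      by_cases e : w = z
      · subst e; simp at hk; exact hk ▸ hh
      · rw [Function.update_of_ne e] at hk
        by_cases e' : w = y
        · subst e'; simp at hk; exact hk ▸ hg
        · simp [Function.update_of_ne e'] at hk)
  convert key using 3 with x
  rw [Tm.subst₂]
  congr 1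
  funext w
  by_cases e : w = z
  · subst e; simp
  · by_cases e' : w = y
    · subst e'; simp [Function.update_of_ne e]
    · simp [Function.update_of_ne e, Function.update_of_ne e']

theorem subst₁ {f g : X → Tm ℝ} (hf : TermFamily f) (y : ℕ) (hg : TermFamily g) :
    TermFamily fun x => (f x).subst₁ y (g x) := by
  -- With both variables equal to `y`, the second update overwrites the first.
  simpa [Tm.subst₁, Tm.subst₂] using hf.subst₂ y hg y hg

end TermFamily

/-! ### Increasing sequences of measures -/

section MonotoneLimit

variable {B : Type} [MeasurableSpace B]

/-- The lattice supremum of measures is not computed setwise in general. For an increasing sequence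
the setwise supremum is countably additive, by monotone convergence for the counting measure, and is
therefore the least upper bound. -/
theorem iSup_measure_apply {μ : ℕ → Measure B} (hμ : Monotone μ) {A : Set B}
    (hA : MeasurableSet A) : (⨆ n, μ n) A = ⨆ n, μ n A := by
  let ν : Measure B := Measure.ofMeasurable (fun s _ => ⨆ n, μ n s) (by simp) (by
    intro s hs hd
    have h := lintegral_iSup (μ := Measure.count) (f := fun n i => μ n (s i))
      (fun n => measurable_of_countable _) (fun n m h i => hμ h (s i))
    simp only [lintegral_count] at h
    rw [h]
    exact iSup_congr fun n => measure_iUnion hd hs)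
  have hν : ∀ s, MeasurableSet s → ν s = ⨆ n, μ n s := fun s hs =>
    Measure.ofMeasurable_apply s hs
  have h : ⨆ n, μ n = ν := by
    refine le_antisymm (iSup_le fun n => Measure.le_iff.2 fun s hs => ?_)
      (Measure.le_iff.2 fun s hs => ?_)
    · rw [hν s hs]; exact le_iSup (fun n => μ n s) n
    · rw [hν s hs]; exact iSup_le fun n => le_iSup μ n s
  rw [h, hν A hA]

theorem lintegral_iSup_measure {μ : ℕ → Measure B} (hμ : Monotone μ) {f : B → ℝ≥0∞}
    (hf : Measurable f) : ∫⁻ b, f b ∂(⨆ n, μ n) = ⨆ n, ∫⁻ b, f b ∂μ n := by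
  refine Measurable.ennreal_induction (fun c s hs => ?_) (fun f g _ hf _ ihf ihg => ?_)
    (fun f hf hm ih => ?_) hf
  · simp only [lintegral_indicator_const hs, iSup_measure_apply hμ hs, ENNReal.mul_iSup]
  · simp only [Pi.add_apply, lintegral_add_left hf, ihf, ihg]
    exact ENNReal.iSup_add_iSup_of_monotone (fun _ _ h => lintegral_mono' (hμ h) le_rfl)
      (fun _ _ h => lintegral_mono' (hμ h) le_rfl)
  · simp only [lintegral_iSup hf hm, ih]
    exact iSup_comm

variable {B' : Type} [MeasurableSpace B']

theorem bind_mono {μ μ' : Measure B} {k k' : B → Measure B'} (hk : Measurable k)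
    (hk' : Measurable k') (h : μ ≤ μ') (hle : ∀ b, k b ≤ k' b) : μ.bind k ≤ μ'.bind k' := by
  refine Measure.le_iff.2 fun s hs => ?_
  rw [Measure.bind_apply hs hk.aemeasurable, Measure.bind_apply hs hk'.aemeasurable]
  exact lintegral_mono' h fun b => hle b s

theorem bind_iSup {μ : ℕ → Measure B} {k : ℕ → B → Measure B'} (hk : ∀ n, Measurable (k n))
    (hμ : Monotone μ) (hm : Monotone k) :
    (⨆ n, μ n).bind (fun b => ⨆ n, k n b) = ⨆ n, (μ n).bind (k n) := by
  have hkb : ∀ b, Monotone fun n => k n b := fun b n m h => hm h b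
  have hsup : Measurable fun b => ⨆ n, k n b := by
    refine Measure.measurable_of_measurable_coe _ fun s hs => ?_
    simp only [iSup_measure_apply (hkb _) hs]
    exact Measurable.iSup fun n => (Measure.measurable_coe hs).comp (hk n)
  ext s hs
  have hms : ∀ n, Measurable fun b => k n b s := fun n => (Measure.measurable_coe hs).comp (hk n)
  rw [iSup_measure_apply (fun n m h => bind_mono (hk n) (hk m) (hμ h) (hm h)) hs,
    Measure.bind_apply hs hsup.aemeasurable]
  simp only [Measure.bind_apply hs (hk _).aemeasurable, iSup_measure_apply (hkb _) hs]
  rw [lintegral_iSup_measure hμ (Measurable.iSup hms)]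
  simp only [lintegral_iSup hms fun n m h b => hm h b s]
  -- A double supremum of a family monotone in both indices is attained along the diagonal, via `max
  -- n m`.
  refine le_antisymm (iSup₂_le fun n m => ?_) (iSup_le fun n => ?_)
  · exact (lintegral_mono' (hμ (le_max_left n m)) fun b => hm (le_max_right n m) b s).trans
      (le_iSup (fun n => ∫⁻ b, k n b s ∂μ n) (max n m))
  · exact le_iSup₂ (f := fun n m => ∫⁻ b, k m b s ∂μ n) n n

end MonotoneLimit

/-! ### Plots and nice kernels -/

/-- A distinguished class of measurable maps into `B`, the plots, which determine the measurable
structure of `B`. -/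
class Plots (B : Type) [MeasurableSpace B] where
  IsPlot : ∀ {Y : Type} [MeasurableSpace Y], (Y → B) → Prop
  constant : ∀ {Y : Type} [MeasurableSpace Y] (b : B), IsPlot fun _ : Y => b
  comp : ∀ {Y Z : Type} [MeasurableSpace Y] [MeasurableSpace Z] {f : Y → B} {a : Z → Y},
    IsPlot f → Measurable a → IsPlot fun z => f (a z)
  measurable : ∀ {Y : Type} [MeasurableSpace Y] {f : Y → B}, IsPlot f → Measurable f
  detect : ∀ {W : Type} [MeasurableSpace W] {g : B → W},
    (∀ (Y : Type) [MeasurableSpace Y] (f : Y → B), IsPlot f → Measurable fun y => g (f y)) →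
    Measurable g

open Plots (IsPlot)

instance : Plots (Tm ℝ) where
  IsPlot f := TermFamily f
  constant := TermFamily.constant
  comp hf ha := hf.comp ha
  measurable hf := hf.measurable
  detect h := TermFamily.measurable_iff.2 fun _ s => h _ _ (.map_template s measurable_id)

instance : Plots ℝ where
  IsPlot f := Measurable f
  constant _ := measurable_const
  comp hf ha := hf.comp ha
  measurable hf := hf
  detect h := h _ _ measurable_id

instance (n : ℕ) : Plots (Fin n → ℝ) where
  IsPlot f := Measurable f
  constant _ := measurable_const
  comp hf ha := hf.comp ha
  measurable hf := hf
  detect h := h _ _ measurable_id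

section Nice

variable {X Y B B' : Type} [MeasurableSpace X] [MeasurableSpace Y] [MeasurableSpace B]
  [MeasurableSpace B'] [Plots B] [Plots B']

/-- Measurability along all plots. -/
def PlotMeasurable (F : X → B → ℝ≥0∞) : Prop :=
  ∀ (Z : Type) [MeasurableSpace Z] (a : Z → X) (f : Z → B), Measurable a → IsPlot f →
    Measurable fun z => F (a z) (f z)

theorem PlotMeasurable.apply {F : X → B → ℝ≥0∞} (hF : PlotMeasurable F) (x : X) :
    Measurable (F x) :=
  Plots.detect fun Y _ f hf => hF Y (fun _ => x) f measurable_const hf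

theorem PlotMeasurable.comp {F : X → B → ℝ≥0∞} (hF : PlotMeasurable F) {a : Y → X}
    (ha : Measurable a) : PlotMeasurable fun y => F (a y) :=
  fun Z _ b f hb hf => hF Z (fun z => a (b z)) f (ha.comp hb) hf

/-- Families of measures against which integration preserves measurability along plots. -/
def Nice (κ : X → Measure B) : Prop :=
  ∀ (Y : Type) [MeasurableSpace Y] (a : Y → X), Measurable a →
    ∀ F : Y → B → ℝ≥0∞, PlotMeasurable F → Measurable fun y => ∫⁻ b, F y b ∂κ (a y)

theorem Nice.lintegral {κ : X → Measure B} (h : Nice κ) {F : X → B → ℝ≥0∞}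
    (hF : PlotMeasurable F) : Measurable fun x => ∫⁻ b, F x b ∂κ x :=
  h X id measurable_id F hF

theorem Nice.measurable {κ : X → Measure B} (h : Nice κ) : Measurable κ := by
  refine Measure.measurable_of_measurable_coe _ fun s hs => ?_
  simp only [← lintegral_indicator_one hs]
  exact h.lintegral (F := fun _ => s.indicator 1) fun Z _ a f _ hf =>
    (measurable_one.indicator hs).comp (Plots.measurable hf)

theorem Nice.comp {κ : X → Measure B} (h : Nice κ) {a : Y → X} (ha : Measurable a) :
    Nice fun y => κ (a y) :=
  fun Z _ b hb F hF => h Z (fun z => a (b z)) (ha.comp hb) F hF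

/-- Maps to measures that are nice along all plots. -/
def NiceMap (k : B → Measure B') : Prop :=
  ∀ (Y : Type) [MeasurableSpace Y] (f : Y → B), IsPlot f → Nice fun y => k (f y)

theorem NiceMap.measurable {k : B → Measure B'} (hk : NiceMap k) : Measurable k :=
  Plots.detect fun Y _ f hf => (hk Y f hf).measurable

theorem Nice.zero : Nice fun _ : X => (0 : Measure B) := by
  intro Y _ a ha F hF
  simp

theorem Nice.dirac {f : X → B} (hf : IsPlot f) : Nice fun x => Measure.dirac (f x) := by
  intro Y _ a ha F hF
  simp only [lintegral_dirac' _ (hF.apply _)]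
  exact hF Y id _ measurable_id (Plots.comp hf ha)

theorem Nice.smul {κ : X → Measure B} (hκ : Nice κ) {c : X → ℝ≥0∞} (hc : Measurable c) :
    Nice fun x => c x • κ x := by
  intro Y _ a ha F hF
  simp only [lintegral_smul_measure]
  exact (hc.comp ha).mul (hκ Y a ha F hF)

open Classical in
theorem Nice.ite {κ κ' : X → Measure B} (hκ : Nice κ) (hκ' : Nice κ') {p : X → Prop}
    (hp : MeasurableSet {x | p x}) : Nice fun x => if p x then κ x else κ' x := by
  intro Y _ a ha F hF
  have : ∀ y, ∫⁻ b, F y b ∂(if p (a y) then κ (a y) else κ' (a y)) =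
      if p (a y) then ∫⁻ b, F y b ∂κ (a y) else ∫⁻ b, F y b ∂κ' (a y) := by
    intro y; split_ifs <;> rfl
  simp only [this]
  exact Measurable.ite (ha hp) (hκ Y a ha F hF) (hκ' Y a ha F hF)

/-- Nice families are closed under Kleisli composition. -/
theorem Nice.bind {κ : X → Measure B} (hκ : Nice κ) {k : X → B → Measure B'}
    (hk : ∀ (Z : Type) [MeasurableSpace Z] (a : Z → X) (f : Z → B), Measurable a → IsPlot f →
      Nice fun z => k (a z) (f z)) : Nice fun x => (κ x).bind (k x) := by
  intro Y _ a ha F hF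
  have hm : ∀ x, Measurable (k x) := fun x =>
    NiceMap.measurable fun Z _ f hf => hk Z (fun _ => x) f measurable_const hf
  simp only [Measure.lintegral_bind (hm _).aemeasurable (hF.apply _).aemeasurable]
  refine hκ Y a ha (fun y b => ∫⁻ c, F y c ∂k (a y) b) fun Z _ b f hb hf => ?_
  exact (hk Z (fun z => a (b z)) f (ha.comp hb) hf).lintegral (hF.comp hb)

theorem Nice.iSup {κ : ℕ → X → Measure B} (hκ : ∀ n, Nice (κ n)) (hm : Monotone κ) :
    Nice fun x => ⨆ n, κ n x := by
  intro Y _ a ha F hF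
  simp only [lintegral_iSup_measure (fun n m h => hm h _) (hF.apply _)]
  exact Measurable.iSup fun n => hκ n Y a ha F hF

/-- A constant family given by an s-finite measure on a space whose plots are the measurable
maps. -/
theorem Nice.of_sFinite (h : IsPlot (id : B → B)) (μ : Measure B) [SFinite μ] :
    Nice fun _ : X => μ := by
  intro Y _ a ha F hF
  -- The two projections form a test pair, so `F` is jointly measurable in the ordinary sense on `Y
  -- × B` and the s-finite theory applies.
  have := hF (Y × B) Prod.fst Prod.snd measurable_fst (Plots.comp (f := id) h measurable_snd)
  exact this.lintegral_prod_right'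

end Nice

/-! ### Measurability of the operational semantics -/

/-- Continuation of the evaluation of a pair after its first component. -/
noncomputable def pairCont (ν : Measure (Tm ℝ)) (v : Tm ℝ) : Measure (Tm ℝ) :=
  ν.bind fun w => Measure.dirac (.pair v w)

/-- Continuation of an application after the function has been evaluated. -/
noncomputable def appCont (next : Tm ℝ → Measure (Tm ℝ)) (ν : Measure (Tm ℝ)) :
    Tm ℝ → Measure (Tm ℝ)
  | .lam x _ b => ν.bind fun w => next (b.subst₁ x w)
  | _ => 0

/-- Continuation of `ifz`. -/
noncomputable def ifzCont (ν₁ ν₂ : Measure (Tm ℝ)) : Tm ℝ → Measure (Tm ℝ) :=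
  onReal fun r => if r = 0 then ν₁ else ν₂

/-- Continuation of `score`. -/
noncomputable def scoreCont : Tm ℝ → Measure (Tm ℝ) :=
  onReal fun r => ENNReal.ofReal |r| • Measure.dirac .unit

/-- Continuation of the match on the unit type. -/
noncomputable def umatchCont (ν : Measure (Tm ℝ)) : Tm ℝ → Measure (Tm ℝ)
  | .unit => ν
  | _ => 0

/-- Continuation of the match on pairs. -/
noncomputable def pmatchCont (next : Tm ℝ → Measure (Tm ℝ)) (x y : ℕ) (s : Tm ℝ) :
    Tm ℝ → Measure (Tm ℝ)
  | .pair v w => next (s.subst₂ x v y w)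
  | _ => 0

/-- Continuation of the match on variants. -/
noncomputable def vmatchCont (next : Tm ℝ → Measure (Tm ℝ)) (L : Finset ℕ)
    (x : {l // l ∈ L} → ℕ) (s : {l // l ∈ L} → Tm ℝ) : Tm ℝ → Measure (Tm ℝ)
  | .inj _ l v => if h : l ∈ L then next ((s ⟨l, h⟩).subst₁ (x ⟨l, h⟩) v) else 0
  | _ => 0

/-- Continuation of the match on recursive types. -/
noncomputable def rmatchCont (next : Tm ℝ → Measure (Tm ℝ)) (x : ℕ) (s : Tm ℝ) :
    Tm ℝ → Measure (Tm ℝ)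
  | .roll _ v => next (s.subst₁ x v)
  | _ => 0

/-- Continuation of the evaluation of a list of arguments after the first one. -/
noncomputable def argsCont {n : ℕ} (ν : Measure (Fin n → ℝ)) : Tm ℝ → Measure (Fin (n + 1) → ℝ) :=
  onReal fun r => ν.bind fun rs => Measure.dirac (Fin.cons r rs)

section Equations

variable (next : Tm ℝ → Measure (Tm ℝ))

/-- Naming the anonymous `match` makes the continuation available to lemmas about niceness,
monotonicity and continuity. -/
theorem evalStep_app (t s : Tm ℝ) :
    evalStep next (.app t s) = (evalStep next t).bind (appCont next (evalStep next s)) := rfl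

theorem evalStep_umatch (t s : Tm ℝ) :
    evalStep next (.umatch t s) = (evalStep next t).bind (umatchCont (evalStep next s)) := rfl

theorem evalStep_pmatch (t : Tm ℝ) (x y : ℕ) (s : Tm ℝ) :
    evalStep next (.pmatch t x y s) = (evalStep next t).bind (pmatchCont next x y s) := rfl

theorem evalStep_vmatch (t : Tm ℝ) (L : Finset ℕ) (x : {l // l ∈ L} → ℕ)
    (s : {l // l ∈ L} → Tm ℝ) :
    evalStep next (.vmatch t L x s) = (evalStep next t).bind (vmatchCont next L x s) := rfl

theorem evalStep_rmatch (t : Tm ℝ) (x : ℕ) (s : Tm ℝ) :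
    evalStep next (.rmatch t x s) = (evalStep next t).bind (rmatchCont next x s) := rfl

end Equations

section Continuations

variable {X : Type} [MeasurableSpace X] {next : Tm ℝ → Measure (Tm ℝ)} {f : X → Tm ℝ}
  {κ κ₁ κ₂ : X → Measure (Tm ℝ)}

theorem nice_pairCont (hκ : Nice κ) (hf : TermFamily f) :
    Nice fun x => pairCont (κ x) (f x) :=
  hκ.bind fun _ _ _ _ ha hg => .dirac (TermFamily.pair (hf.comp ha) hg)

/-- This is where plots pay off: all members of a plot share their head constructor, so `cases`
resolves the match uniformly in the parameter. The other matching continuations are treated in the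
same way. -/
theorem nice_appCont (hn : NiceMap next) (hκ : Nice κ) (hf : TermFamily f) :
    Nice fun x => appCont next (κ x) (f x) := by
  cases hf
  case lam z τ b hb =>
    exact hκ.bind fun _ _ _ _ ha hg => hn _ _ ((hb.comp ha).subst₁ z hg)
  all_goals exact .zero

theorem nice_ifzCont (h₁ : Nice κ₁) (h₂ : Nice κ₂) (hf : TermFamily f) :
    Nice fun x => ifzCont (κ₁ x) (κ₂ x) (f x) := by
  cases hf
  case const r hr =>
    have := h₁.ite h₂ (p := fun x => r x = 0) (hr (measurableSet_singleton 0))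
    convert this using 2
    simp only [ifzCont, onReal]
  all_goals exact .zero

theorem nice_scoreCont (hf : TermFamily f) : Nice fun x => scoreCont (f x) := by
  cases hf
  case const r hr =>
    exact (Nice.dirac (f := fun _ : X => Tm.unit) TermFamily.unit).smul
      (c := fun x => ENNReal.ofReal |r x|) (by fun_prop)
  all_goals exact .zero

theorem nice_umatchCont (hκ : Nice κ) (hf : TermFamily f) :
    Nice fun x => umatchCont (κ x) (f x) := by
  cases hf
  case unit => exact hκ
  all_goals exact .zero

theorem nice_pmatchCont (hn : NiceMap next) (y z : ℕ) {s : X → Tm ℝ} (hs : TermFamily s)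
    (hf : TermFamily f) : Nice fun x => pmatchCont next y z (s x) (f x) := by
  cases hf
  case pair v w hv hw => exact hn _ _ (hs.subst₂ y hv z hw)
  all_goals exact .zero

theorem nice_vmatchCont (hn : NiceMap next) (L : Finset ℕ) (z : {l // l ∈ L} → ℕ)
    {s : {l // l ∈ L} → X → Tm ℝ} (hs : ∀ l, TermFamily (s l)) (hf : TermFamily f) :
    Nice fun x => vmatchCont next L z (fun l => s l x) (f x) := by
  cases hf
  case inj τ l v hv =>
    by_cases h : l ∈ L
    · simp only [vmatchCont, h, dite_true]
      exact hn _ _ ((hs ⟨l, h⟩).subst₁ _ hv)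
    · simp only [vmatchCont, h, dite_false]
      exact .zero
  all_goals exact .zero

theorem nice_rmatchCont (hn : NiceMap next) (z : ℕ) {s : X → Tm ℝ} (hs : TermFamily s)
    (hf : TermFamily f) : Nice fun x => rmatchCont next z (s x) (f x) := by
  cases hf
  case roll τ v hv => exact hn _ _ (hs.subst₁ z hv)
  all_goals exact .zero

theorem nice_argsCont {n : ℕ} {κ : X → Measure (Fin n → ℝ)} (hκ : Nice κ) (hf : TermFamily f) :
    Nice fun x => argsCont (κ x) (f x) := by
  cases hf
  case const r hr =>
    refine hκ.bind fun Z _ a g ha hg => ?_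
    have hg : Measurable g := hg
    have : Measurable fun z => (Fin.cons (r (a z)) (g z) : Fin (n + 1) → ℝ) := by
      refine measurable_pi_iff.2 fun i => ?_
      refine Fin.cases ?_ (fun i => ?_) i
      · exact hr.comp ha
      · exact (measurable_pi_apply i).comp hg
    exact Nice.dirac this
  all_goals exact .zero

theorem nice_evalArgs {n : ℕ} {κ : X → Fin n → Measure (Tm ℝ)}
    (hκ : ∀ i, Nice fun x => κ x i) : Nice fun x => evalArgs n (κ x) := by
  induction n with
  | zero => exact .dirac (f := fun _ => Fin.elim0) measurable_const
  | succ n ih =>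
    exact (hκ 0).bind fun Z _ a g ha hg =>
      nice_argsCont ((ih fun i => hκ i.succ).comp ha) hg

theorem niceMap_primEval {n : ℕ} (f : PrimFn n) : NiceMap f.eval := by
  classical
  have hdom : MeasurableSet {r | (f.toPFun r).Dom} := by
    convert f.measurableSet_preimage Set.univ MeasurableSet.univ using 1
    ext r; simp [Part.dom_iff_mem]
  -- The value `0` off the domain is arbitrary, since the zero measure is used there.
  let g : (Fin n → ℝ) → ℝ := fun r => if h : (f.toPFun r).Dom then (f.toPFun r).get h else 0
  have hg : Measurable g := by
    intro A hA
    have : g ⁻¹' A = f.toPFun.preimage A ∪ ({r | (f.toPFun r).Dom}ᶜ ∩ {_r | (0 : ℝ) ∈ A}) := by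
      ext r
      by_cases h : (f.toPFun r).Dom
      · simp only [g, Set.mem_preimage, h, dite_true, PFun.mem_preimage, Set.mem_union,
          Set.mem_inter_iff, Set.mem_compl_iff, Set.mem_ofPred_eq, not_true, false_and, or_false]
        exact ⟨fun hm => ⟨_, hm, Part.get_mem h⟩, fun ⟨y, hy, hm⟩ => by
          rwa [Part.get_eq_of_mem hm h]⟩
      · simp only [g, Set.mem_preimage, h, dite_false, PFun.mem_preimage, Set.mem_union,
          Set.mem_inter_iff, Set.mem_compl_iff, Set.mem_ofPred_eq, not_false_eq_true, true_and]
        exact ⟨Or.inr, fun hm => hm.resolve_left fun ⟨y, _, hm⟩ => h (Part.dom_iff_mem.2 ⟨y, hm⟩)⟩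
    rw [this]
    exact (f.measurableSet_preimage A hA).union (hdom.compl.inter (MeasurableSet.const _))
  intro Y _ a ha
  have ha : Measurable a := ha
  have := (Nice.dirac (f := fun y => Tm.const (g (a y))) (TermFamily.const (hg.comp ha))).ite
    .zero (p := fun y => (f.toPFun (a y)).Dom) (ha hdom)
  convert this using 2 with y
  by_cases h : (f.toPFun (a y)).Dom <;> simp [PrimFn.eval, g, h]

/-- Uniform distribution on the unit interval. -/
noncomputable abbrev uniform : Measure ℝ := volume.restrict (Set.Icc (0 : ℝ) 1)

theorem niceMap_constDirac : NiceMap fun r : ℝ => Measure.dirac (Tm.const r) :=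
  fun _ _ _ ha => .dirac (TermFamily.const ha)

/-- Induction over the shared template of a plot. Bodies entered by substitution go to `next` and
are covered by the hypothesis on it, not by the induction. -/
theorem niceMap_evalStep (hn : NiceMap next) : NiceMap (evalStep next) := by
  intro X _ f hf
  change TermFamily f at hf
  induction hf with
  | hole => exact .zero
  | var z => exact .zero
  | const hr => exact .dirac (TermFamily.const hr)
  | prim n f _ ih => exact (nice_evalArgs ih).bind fun _ _ _ g _ hg => niceMap_primEval f _ g hg
  | ifz _ _ _ ih₁ ih₂ ih₃ =>
    exact ih₁.bind fun _ _ _ _ ha hg => nice_ifzCont (ih₂.comp ha) (ih₃.comp ha) hg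
  | sample =>
    exact (Nice.of_sFinite (B := ℝ) measurable_id uniform).bind fun _ _ _ _ _ hg =>
      niceMap_constDirac _ _ hg
  | score _ ih => exact ih.bind fun _ _ _ _ _ hg => nice_scoreCont hg
  | unit => exact .dirac TermFamily.unit
  | pair _ _ ih₁ ih₂ => exact ih₁.bind fun _ _ _ _ ha hg => nice_pairCont (ih₂.comp ha) hg
  | inj τ l _ ih => exact ih.bind fun _ _ _ _ _ hg => .dirac (TermFamily.inj τ l hg)
  | roll τ _ ih => exact ih.bind fun _ _ _ _ _ hg => .dirac (TermFamily.roll τ hg)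
  | lam z τ ht _ => exact .dirac (TermFamily.lam z τ ht)
  | app _ _ ih₁ ih₂ =>
    simp only [evalStep_app]
    exact ih₁.bind fun _ _ _ _ ha hg => nice_appCont hn (ih₂.comp ha) hg
  | umatch _ _ ih₁ ih₂ =>
    simp only [evalStep_umatch]
    exact ih₁.bind fun _ _ _ _ ha hg => nice_umatchCont (ih₂.comp ha) hg
  | pmatch y z _ hs ih₁ _ =>
    simp only [evalStep_pmatch]
    exact ih₁.bind fun _ _ _ _ ha hg => nice_pmatchCont hn y z (hs.comp ha) hg
  | vmatch L z _ hs ih₁ _ =>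
    simp only [evalStep_vmatch]
    exact ih₁.bind fun _ _ _ _ ha hg => nice_vmatchCont hn L z (fun l => (hs l).comp ha) hg
  | rmatch z _ hs ih₁ _ =>
    simp only [evalStep_rmatch]
    exact ih₁.bind fun _ _ _ _ ha hg => nice_rmatchCont hn z (hs.comp ha) hg

theorem niceMap_evalN (n : ℕ) : NiceMap (evalN n) := by
  induction n with
  | zero => exact fun _ _ _ _ => .zero
  | succ n ih => exact niceMap_evalStep ih

end Continuations

/-! ### Continuity of the operational semantics -/

section Continuity

/-- Measures against which integration preserves measurability along plots. -/
def NiceMeasure {B : Type} [MeasurableSpace B] [Plots B] (ν : Measure B) : Prop :=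
  Nice fun _ : Unit => ν

theorem NiceMeasure.nice {B X : Type} [MeasurableSpace B] [Plots B] [MeasurableSpace X]
    {ν : Measure B} (h : NiceMeasure ν) : Nice fun _ : X => ν :=
  Nice.comp (a := fun _ : X => ()) h measurable_const

theorem NiceMap.apply {B B' : Type} [MeasurableSpace B] [Plots B] [MeasurableSpace B'] [Plots B']
    {k : B → Measure B'} (hk : NiceMap k) (b : B) : NiceMeasure (k b) :=
  hk Unit (fun _ => b) (Plots.constant b)

theorem NiceMeasure.evalArgs {n : ℕ} {μ : Fin n → Measure (Tm ℝ)} (h : ∀ i, NiceMeasure (μ i)) :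
    NiceMeasure (evalArgs n μ) :=
  nice_evalArgs h

variable {next next' : Tm ℝ → Measure (Tm ℝ)} {ν ν₁ ν₂ : Measure (Tm ℝ)}

theorem niceMap_pairCont (h : NiceMeasure ν) : NiceMap (pairCont ν) :=
  fun _ _ _ hf => nice_pairCont h.nice hf

theorem niceMap_appCont (hn : NiceMap next) (h : NiceMeasure ν) : NiceMap (appCont next ν) :=
  fun _ _ _ hf => nice_appCont hn h.nice hf

theorem niceMap_ifzCont (h₁ : NiceMeasure ν₁) (h₂ : NiceMeasure ν₂) : NiceMap (ifzCont ν₁ ν₂) :=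
  fun _ _ _ hf => nice_ifzCont h₁.nice h₂.nice hf

theorem niceMap_scoreCont : NiceMap scoreCont := fun _ _ _ hf => nice_scoreCont hf

theorem niceMap_umatchCont (h : NiceMeasure ν) : NiceMap (umatchCont ν) :=
  fun _ _ _ hf => nice_umatchCont h.nice hf

theorem niceMap_pmatchCont (hn : NiceMap next) (x y : ℕ) (s : Tm ℝ) :
    NiceMap (pmatchCont next x y s) :=
  fun _ _ _ hf => nice_pmatchCont hn x y (.constant s) hf

theorem niceMap_vmatchCont (hn : NiceMap next) (L : Finset ℕ) (x : {l // l ∈ L} → ℕ)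
    (s : {l // l ∈ L} → Tm ℝ) : NiceMap (vmatchCont next L x s) :=
  fun _ _ _ hf => nice_vmatchCont hn L x (fun l => .constant (s l)) hf

theorem niceMap_rmatchCont (hn : NiceMap next) (x : ℕ) (s : Tm ℝ) :
    NiceMap (rmatchCont next x s) :=
  fun _ _ _ hf => nice_rmatchCont hn x (.constant s) hf

theorem niceMap_argsCont {n : ℕ} {ν : Measure (Fin n → ℝ)} (h : NiceMeasure ν) :
    NiceMap (argsCont ν) :=
  fun _ _ _ hf => nice_argsCont h.nice hf

theorem niceMap_pairDirac (v : Tm ℝ) : NiceMap fun w => Measure.dirac (Tm.pair v w) :=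
  fun _ _ _ hf => .dirac (TermFamily.pair (.constant v) hf)

theorem niceMap_injDirac (τ : Ty 0) (l : ℕ) :
    NiceMap fun v : Tm ℝ => Measure.dirac (Tm.inj τ l v) :=
  fun _ _ _ hf => .dirac (TermFamily.inj τ l hf)

theorem niceMap_rollDirac (τ : Ty 0) : NiceMap fun v : Tm ℝ => Measure.dirac (Tm.roll τ v) :=
  fun _ _ _ hf => .dirac (TermFamily.roll τ hf)

theorem niceMap_consDirac {n : ℕ} (r : ℝ) :
    NiceMap fun rs : Fin n → ℝ => Measure.dirac (Fin.cons r rs : Fin (n + 1) → ℝ) := by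
  intro Y _ f hf
  have hf : Measurable f := hf
  have : Measurable fun y => (Fin.cons r (f y) : Fin (n + 1) → ℝ) := by
    refine measurable_pi_iff.2 fun i => ?_
    refine Fin.cases ?_ (fun i => ?_) i
    · exact measurable_const
    · exact (measurable_pi_apply i).comp hf
  exact Nice.dirac this

theorem niceMap_subst₁ (hn : NiceMap next) (b : Tm ℝ) (x : ℕ) :
    NiceMap fun w => next (b.subst₁ x w) :=
  fun _ _ _ hf => hn _ _ ((TermFamily.constant b).subst₁ x hf)

theorem pairCont_mono (h : ν₁ ≤ ν₂) (v : Tm ℝ) : pairCont ν₁ v ≤ pairCont ν₂ v :=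
  bind_mono (niceMap_pairDirac v).measurable (niceMap_pairDirac v).measurable h fun _ => le_rfl

theorem appCont_mono (hn : NiceMap next) (hn' : NiceMap next') (hle : ∀ u, next u ≤ next' u)
    (h : ν₁ ≤ ν₂) (v : Tm ℝ) : appCont next ν₁ v ≤ appCont next' ν₂ v := by
  cases v
  case lam x τ b =>
    exact bind_mono (niceMap_subst₁ hn b x).measurable (niceMap_subst₁ hn' b x).measurable h
      fun _ => hle _
  all_goals exact le_rfl

theorem ifzCont_mono {ν₁' ν₂' : Measure (Tm ℝ)} (h₁ : ν₁ ≤ ν₁') (h₂ : ν₂ ≤ ν₂') (v : Tm ℝ) :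
    ifzCont ν₁ ν₂ v ≤ ifzCont ν₁' ν₂' v := by
  cases v
  case const r =>
    simp only [ifzCont, onReal]
    split_ifs
    exacts [h₁, h₂]
  all_goals exact le_rfl

theorem umatchCont_mono (h : ν₁ ≤ ν₂) (v : Tm ℝ) : umatchCont ν₁ v ≤ umatchCont ν₂ v := by
  cases v
  case unit => exact h
  all_goals exact le_rfl

theorem pmatchCont_mono (hle : ∀ u, next u ≤ next' u) (x y : ℕ) (s v : Tm ℝ) :
    pmatchCont next x y s v ≤ pmatchCont next' x y s v := by
  cases v
  case pair => exact hle _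
  all_goals exact le_rfl

theorem vmatchCont_mono (hle : ∀ u, next u ≤ next' u) (L : Finset ℕ) (x : {l // l ∈ L} → ℕ)
    (s : {l // l ∈ L} → Tm ℝ) (v : Tm ℝ) : vmatchCont next L x s v ≤ vmatchCont next' L x s v := by
  cases v
  case inj =>
    simp only [vmatchCont]
    split_ifs
    exacts [hle _, le_rfl]
  all_goals exact le_rfl

theorem rmatchCont_mono (hle : ∀ u, next u ≤ next' u) (x : ℕ) (s v : Tm ℝ) :
    rmatchCont next x s v ≤ rmatchCont next' x s v := by
  cases v
  case roll => exact hle _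
  all_goals exact le_rfl

theorem argsCont_mono {n : ℕ} {ν₁ ν₂ : Measure (Fin n → ℝ)} (h : ν₁ ≤ ν₂) (v : Tm ℝ) :
    argsCont ν₁ v ≤ argsCont ν₂ v := by
  cases v
  case const r =>
    exact bind_mono (niceMap_consDirac r).measurable (niceMap_consDirac r).measurable h
      fun _ => le_rfl
  all_goals exact le_rfl

theorem evalArgs_mono {n : ℕ} {μ μ' : Fin n → Measure (Tm ℝ)} (hμ : ∀ i, NiceMeasure (μ i))
    (hμ' : ∀ i, NiceMeasure (μ' i)) (h : ∀ i, μ i ≤ μ' i) : evalArgs n μ ≤ evalArgs n μ' := by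
  induction n with
  | zero => exact le_rfl
  | succ n ih =>
    exact bind_mono (niceMap_argsCont (.evalArgs fun i => hμ i.succ)).measurable
      (niceMap_argsCont (.evalArgs fun i => hμ' i.succ)).measurable (h 0)
      (argsCont_mono (ih (fun i => hμ i.succ) (fun i => hμ' i.succ) fun i => h i.succ))

theorem evalStep_mono (hn : NiceMap next) (hn' : NiceMap next') (hle : ∀ u, next u ≤ next' u)
    (t : Tm ℝ) : evalStep next t ≤ evalStep next' t := by
  have H := (niceMap_evalStep hn).apply
  have H' := (niceMap_evalStep hn').apply
  induction t with
  | prim n f t ih =>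
    exact bind_mono (niceMap_primEval f).measurable (niceMap_primEval f).measurable
      (evalArgs_mono (fun i => H (t i)) (fun i => H' (t i)) ih) fun _ => le_rfl
  | ifz t s₁ s₂ ih ih₁ ih₂ =>
    exact bind_mono (niceMap_ifzCont (H s₁) (H s₂)).measurable
      (niceMap_ifzCont (H' s₁) (H' s₂)).measurable ih (ifzCont_mono ih₁ ih₂)
  | score t ih =>
    exact bind_mono niceMap_scoreCont.measurable niceMap_scoreCont.measurable ih fun _ => le_rfl
  | pair t s ih₁ ih₂ =>
    exact bind_mono (niceMap_pairCont (H s)).measurable (niceMap_pairCont (H' s)).measurable ih₁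
      (pairCont_mono ih₂)
  | inj τ l t ih =>
    exact bind_mono (niceMap_injDirac τ l).measurable (niceMap_injDirac τ l).measurable ih
      fun _ => le_rfl
  | roll τ t ih =>
    exact bind_mono (niceMap_rollDirac τ).measurable (niceMap_rollDirac τ).measurable ih
      fun _ => le_rfl
  | app t s ih₁ ih₂ =>
    exact bind_mono (niceMap_appCont hn (H s)).measurable (niceMap_appCont hn' (H' s)).measurable
      ih₁ (appCont_mono hn hn' hle ih₂)
  | umatch t s ih₁ ih₂ =>
    exact bind_mono (niceMap_umatchCont (H s)).measurable (niceMap_umatchCont (H' s)).measurable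
      ih₁ (umatchCont_mono ih₂)
  | pmatch t x y s ih₁ _ =>
    exact bind_mono (niceMap_pmatchCont hn x y s).measurable
      (niceMap_pmatchCont hn' x y s).measurable ih₁ (pmatchCont_mono hle x y s)
  | vmatch t L x s ih₁ _ =>
    exact bind_mono (niceMap_vmatchCont hn L x s).measurable
      (niceMap_vmatchCont hn' L x s).measurable ih₁ (vmatchCont_mono hle L x s)
  | rmatch t x s ih₁ _ =>
    exact bind_mono (niceMap_rmatchCont hn x s).measurable
      (niceMap_rmatchCont hn' x s).measurable ih₁ (rmatchCont_mono hle x s)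
  | _ => exact le_rfl

theorem evalN_mono : Monotone evalN := by
  refine monotone_nat_of_le_succ fun n => ?_
  induction n with
  | zero => exact fun _ => Measure.zero_le _
  | succ n ih => exact evalStep_mono (niceMap_evalN n) (niceMap_evalN (n + 1)) ih

theorem evalN_mono_apply (t : Tm ℝ) : Monotone fun n => evalN n t := fun _ _ h => evalN_mono h t

theorem niceMap_eval : NiceMap eval := fun X _ f hf =>
  Nice.iSup (κ := fun n x => evalN n (f x)) (fun n => niceMap_evalN n X f hf)
    fun _ _ h x => evalN_mono h (f x)

/-- A variant of `bind_iSup` for measures and kernels presented as suprema. -/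
theorem bind_eq_iSup {B B' : Type} [MeasurableSpace B] [MeasurableSpace B'] {μ' : Measure B}
    {k' : B → Measure B'} {μ : ℕ → Measure B} {k : ℕ → B → Measure B'}
    (hk : ∀ n, Measurable (k n)) (hμ : Monotone μ) (hm : ∀ n m, n ≤ m → ∀ b, k n b ≤ k m b)
    (hμ' : μ' = ⨆ n, μ n) (hk' : ∀ b, k' b = ⨆ n, k n b) :
    μ'.bind k' = ⨆ n, (μ n).bind (k n) := by
  obtain rfl : k' = fun b => ⨆ n, k n b := funext hk'
  rw [hμ', bind_iSup hk hμ fun n m h b => hm n m h b]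

variable {κ κ₁ κ₂ : ℕ → Measure (Tm ℝ)} {nexts : ℕ → Tm ℝ → Measure (Tm ℝ)}

theorem pairCont_iSup (h : Monotone κ) (v : Tm ℝ) :
    pairCont (⨆ n, κ n) v = ⨆ n, pairCont (κ n) v :=
  bind_eq_iSup (fun _ => (niceMap_pairDirac v).measurable) h (fun _ _ _ _ => le_rfl) rfl
    fun _ => iSup_const.symm

theorem appCont_iSup (hn : ∀ n, NiceMap (nexts n)) (hm : Monotone nexts) (h : Monotone κ)
    (v : Tm ℝ) :
    appCont (fun u => ⨆ n, nexts n u) (⨆ n, κ n) v = ⨆ n, appCont (nexts n) (κ n) v := by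
  cases v
  case lam x τ b =>
    exact bind_eq_iSup (fun n => (niceMap_subst₁ (hn n) b x).measurable) h
      (fun _ _ h _ => hm h _) rfl fun _ => rfl
  all_goals exact iSup_const.symm

theorem ifzCont_iSup (v : Tm ℝ) :
    ifzCont (⨆ n, κ₁ n) (⨆ n, κ₂ n) v = ⨆ n, ifzCont (κ₁ n) (κ₂ n) v := by
  cases v
  case const r => simp only [ifzCont, onReal]; split_ifs <;> rfl
  all_goals exact iSup_const.symm

theorem umatchCont_iSup (v : Tm ℝ) : umatchCont (⨆ n, κ n) v = ⨆ n, umatchCont (κ n) v := by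
  cases v
  case unit => rfl
  all_goals exact iSup_const.symm

theorem pmatchCont_iSup (x y : ℕ) (s v : Tm ℝ) :
    pmatchCont (fun u => ⨆ n, nexts n u) x y s v = ⨆ n, pmatchCont (nexts n) x y s v := by
  cases v
  case pair => rfl
  all_goals exact iSup_const.symm

theorem vmatchCont_iSup (L : Finset ℕ) (x : {l // l ∈ L} → ℕ) (s : {l // l ∈ L} → Tm ℝ)
    (v : Tm ℝ) :
    vmatchCont (fun u => ⨆ n, nexts n u) L x s v = ⨆ n, vmatchCont (nexts n) L x s v := by
  cases v
  case inj =>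
    simp only [vmatchCont]
    split_ifs
    exacts [rfl, iSup_const.symm]
  all_goals exact iSup_const.symm

theorem rmatchCont_iSup (x : ℕ) (s v : Tm ℝ) :
    rmatchCont (fun u => ⨆ n, nexts n u) x s v = ⨆ n, rmatchCont (nexts n) x s v := by
  cases v
  case roll => rfl
  all_goals exact iSup_const.symm

theorem argsCont_iSup {m : ℕ} {κ : ℕ → Measure (Fin m → ℝ)} (h : Monotone κ) (v : Tm ℝ) :
    argsCont (⨆ n, κ n) v = ⨆ n, argsCont (κ n) v := by
  cases v
  case const r =>
    exact bind_eq_iSup (fun _ => (niceMap_consDirac r).measurable) h (fun _ _ _ _ => le_rfl) rfl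
      fun _ => iSup_const.symm
  all_goals simp only [argsCont, onReal, iSup_const]

theorem evalArgs_iSup {m : ℕ} {μ : ℕ → Fin m → Measure (Tm ℝ)}
    (hμ : ∀ n i, NiceMeasure (μ n i)) (h : Monotone μ) :
    evalArgs m (fun i => ⨆ n, μ n i) = ⨆ n, evalArgs m (μ n) := by
  induction m with
  | zero => exact iSup_const.symm
  | succ m ih =>
    have hs : ∀ n n', n ≤ n' → evalArgs m (fun i => μ n i.succ) ≤ evalArgs m fun i => μ n' i.succ :=
      fun n n' hle => evalArgs_mono (fun i => hμ n i.succ) (fun i => hμ n' i.succ)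
        fun i => h hle i.succ
    refine bind_eq_iSup (fun n => (niceMap_argsCont (.evalArgs fun i => hμ n i.succ)).measurable)
      (fun n n' hle => h hle 0) (fun n n' hle => argsCont_mono (hs n n' hle)) rfl fun v => ?_
    rw [ih (μ := fun n i => μ n i.succ) (fun n i => hμ n i.succ) fun n n' hle i => h hle i.succ]
    exact argsCont_iSup hs v

/-- Continuity of the one-step functional: each compound evaluation is a `bind`, which preserves
increasing suprema jointly in the measure and in the kernel. -/
theorem evalStep_iSup (hn : ∀ n, NiceMap (nexts n)) (hm : Monotone nexts) (t : Tm ℝ) :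
    evalStep (fun u => ⨆ n, nexts n u) t = ⨆ n, evalStep (nexts n) t := by
  have H : ∀ n t, NiceMeasure (evalStep (nexts n) t) := fun n => (niceMap_evalStep (hn n)).apply
  have M : ∀ t, Monotone fun n => evalStep (nexts n) t := fun t n n' h =>
    evalStep_mono (hn n) (hn n') (hm h) t
  induction t with
  | prim n f t ih =>
    refine bind_eq_iSup (fun _ => (niceMap_primEval f).measurable)
      (fun a b h => evalArgs_mono (fun i => H a (t i)) (fun i => H b (t i)) fun i => M (t i) h)
      (fun _ _ _ _ => le_rfl) ?_ fun _ => iSup_const.symm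
    simp only [ih]
    exact evalArgs_iSup (fun n i => H n (t i)) fun _ _ h i => M (t i) h
  | ifz t s₁ s₂ ih ih₁ ih₂ =>
    refine bind_eq_iSup (fun n => (niceMap_ifzCont (H n s₁) (H n s₂)).measurable) (M t)
      (fun _ _ h => ifzCont_mono (M s₁ h) (M s₂ h)) ih fun v => ?_
    rw [ih₁, ih₂]; exact ifzCont_iSup v
  | score t ih =>
    exact bind_eq_iSup (fun _ => niceMap_scoreCont.measurable) (M t) (fun _ _ _ _ => le_rfl) ih
      fun _ => iSup_const.symm
  | pair t s ih₁ ih₂ =>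
    refine bind_eq_iSup (fun n => (niceMap_pairCont (H n s)).measurable) (M t)
      (fun _ _ h => pairCont_mono (M s h)) ih₁ fun v => ?_
    rw [ih₂]; exact pairCont_iSup (M s) v
  | inj τ l t ih =>
    exact bind_eq_iSup (fun _ => (niceMap_injDirac τ l).measurable) (M t) (fun _ _ _ _ => le_rfl)
      ih fun _ => iSup_const.symm
  | roll τ t ih =>
    exact bind_eq_iSup (fun _ => (niceMap_rollDirac τ).measurable) (M t) (fun _ _ _ _ => le_rfl)
      ih fun _ => iSup_const.symm
  | app t s ih₁ ih₂ =>
    simp only [evalStep_app]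
    refine bind_eq_iSup (fun n => (niceMap_appCont (hn n) (H n s)).measurable) (M t)
      (fun a b h => appCont_mono (hn a) (hn b) (hm h) (M s h)) ih₁ fun v => ?_
    rw [ih₂]; exact appCont_iSup hn hm (M s) v
  | umatch t s ih₁ ih₂ =>
    simp only [evalStep_umatch]
    refine bind_eq_iSup (fun n => (niceMap_umatchCont (H n s)).measurable)
      (M t) (fun _ _ h => umatchCont_mono (M s h)) ih₁ fun v => ?_
    rw [ih₂]; exact umatchCont_iSup v
  | pmatch t x y s ih₁ _ =>
    simp only [evalStep_pmatch]
    exact bind_eq_iSup (fun n => (niceMap_pmatchCont (hn n) x y s).measurable) (M t)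
      (fun _ _ h => pmatchCont_mono (hm h) x y s) ih₁ (pmatchCont_iSup x y s)
  | vmatch t L x s ih₁ _ =>
    simp only [evalStep_vmatch]
    exact bind_eq_iSup (fun n => (niceMap_vmatchCont (hn n) L x s).measurable) (M t)
      (fun _ _ h => vmatchCont_mono (hm h) L x s) ih₁ (vmatchCont_iSup L x s)
  | rmatch t x s ih₁ _ =>
    simp only [evalStep_rmatch]
    exact bind_eq_iSup (fun n => (niceMap_rmatchCont (hn n) x s).measurable) (M t)
      (fun _ _ h => rmatchCont_mono (hm h) x s) ih₁ (rmatchCont_iSup x s)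
  | _ => exact iSup_const.symm

/-- The evaluation kernel is a fixed point of the one-step functional. -/
theorem eval_eq_evalStep (t : Tm ℝ) : eval t = evalStep eval t := by
  have h := evalStep_iSup niceMap_evalN evalN_mono t
  refine Eq.trans ?_ h.symm
  -- Dropping the term at index `0` leaves the supremum of an increasing sequence unchanged.
  exact ((evalN_mono_apply t).iSup_nat_add 1).symm

end Continuity

/-! ### Commutation of iterated integrals -/

section Commute

variable {B B' : Type} [MeasurableSpace B] [MeasurableSpace B'] [Plots B] [Plots B']

/-- Joint measurability along plots. -/
def JointlyPlotMeasurable (F : B → B' → ℝ≥0∞) : Prop :=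
  ∀ (Z : Type) [MeasurableSpace Z] (f : Z → B) (f' : Z → B'), IsPlot f → IsPlot f' →
    Measurable fun z => F (f z) (f' z)

/-- The conclusion of Tonelli's theorem for functions that are jointly measurable along plots. -/
def CommuteMeas (μ : Measure B) (ν : Measure B') : Prop :=
  ∀ F : B → B' → ℝ≥0∞, JointlyPlotMeasurable F →
    ∫⁻ b, ∫⁻ c, F b c ∂ν ∂μ = ∫⁻ c, ∫⁻ b, F b c ∂μ ∂ν

theorem JointlyPlotMeasurable.swap {F : B → B' → ℝ≥0∞} (hF : JointlyPlotMeasurable F) :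
    JointlyPlotMeasurable fun c b => F b c :=
  fun _ _ f f' hf hf' => hF _ f' f hf' hf

theorem JointlyPlotMeasurable.left {F : B → B' → ℝ≥0∞} (hF : JointlyPlotMeasurable F) (c : B') :
    Measurable fun b => F b c :=
  Plots.detect fun Z _ f hf => hF Z f (fun _ => c) hf (Plots.constant c)

theorem JointlyPlotMeasurable.lintegral {F : B → B' → ℝ≥0∞} (hF : JointlyPlotMeasurable F)
    {ν : Measure B'} (hν : NiceMeasure ν) : Measurable fun b => ∫⁻ c, F b c ∂ν :=
  Plots.detect fun _ _ f hf => hν.nice.lintegral (F := fun z c => F (f z) c)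
    fun W _ a g ha hg => hF W (fun w => f (a w)) g (Plots.comp hf ha) hg

theorem CommuteMeas.symm {μ : Measure B} {ν : Measure B'} (h : CommuteMeas μ ν) :
    CommuteMeas ν μ :=
  fun F hF => (h (fun b c => F c b) hF.swap).symm

theorem CommuteMeas.zero {ν : Measure B'} : CommuteMeas (0 : Measure B) ν := by
  intro F _; simp

theorem CommuteMeas.dirac {ν : Measure B'} (hν : NiceMeasure ν) (b : B) :
    CommuteMeas (Measure.dirac b) ν := by
  intro F hF
  rw [lintegral_dirac' _ (hF.lintegral hν)]
  simp only [lintegral_dirac' _ (hF.left _)]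

theorem CommuteMeas.smul {μ : Measure B} {ν : Measure B'} (hμ : NiceMeasure μ)
    (h : CommuteMeas μ ν) (r : ℝ≥0∞) : CommuteMeas (r • μ) ν := by
  intro F hF
  simp only [lintegral_smul_measure, h F hF, smul_eq_mul]
  rw [lintegral_const_mul _ (hF.swap.lintegral hμ)]

/-- Interchange `k a` with `ν` for each fixed `a`; integrating `F` against `k a` then gives a
jointly plot-measurable function, to which the interchange of `μ` and `ν` applies. Niceness supplies
the measurability in between. -/
theorem CommuteMeas.bind {A : Type} [MeasurableSpace A] [Plots A] {μ : Measure A}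
    {ν : Measure B'} {k : A → Measure B} (hν : NiceMeasure ν) (h : CommuteMeas μ ν)
    (hk : NiceMap k) (hkν : ∀ a, CommuteMeas (k a) ν) : CommuteMeas (μ.bind k) ν := by
  intro F hF
  rw [Measure.lintegral_bind hk.measurable.aemeasurable (hF.lintegral hν).aemeasurable]
  simp only [Measure.lintegral_bind hk.measurable.aemeasurable (hF.left _).aemeasurable]
  simp only [hkν _ F hF]
  refine h (fun a c => ∫⁻ b, F b c ∂k a) fun Z _ f f' hf hf' => ?_
  exact (hk Z f hf).lintegral (F := fun z b => F b (f' z))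
    fun W _ a g ha hg => hF W g (fun w => f' (a w)) hg (Plots.comp hf' ha)

theorem CommuteMeas.iSup {μ : ℕ → Measure B} {ν : Measure B'} (hμ : ∀ n, NiceMeasure (μ n))
    (hν : NiceMeasure ν) (hm : Monotone μ) (h : ∀ n, CommuteMeas (μ n) ν) :
    CommuteMeas (⨆ n, μ n) ν := by
  intro F hF
  rw [lintegral_iSup_measure hm (hF.lintegral hν)]
  simp only [lintegral_iSup_measure hm (hF.left _), h _ F hF]
  rw [lintegral_iSup (fun n => hF.swap.lintegral (hμ n))
    fun n n' h c => lintegral_mono' (hm h) le_rfl]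

/-- The only exchange that rests on Tonelli's theorem itself; all others are inherited from it. -/
theorem CommuteMeas.uniform : CommuteMeas uniform uniform := by
  intro F hF
  have h := hF (ℝ × ℝ) Prod.fst Prod.snd measurable_fst measurable_snd
  exact lintegral_lintegral_swap h.aemeasurable

variable {next : Tm ℝ → Measure (Tm ℝ)} {ν : Measure B'}

theorem CommuteMeas.evalArgs {n : ℕ} {μ : Fin n → Measure (Tm ℝ)} (hν : NiceMeasure ν)
    (hμ : ∀ i, NiceMeasure (μ i)) (h : ∀ i, CommuteMeas (μ i) ν) :
    CommuteMeas (evalArgs n μ) ν := by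
  induction n with
  | zero => exact .dirac hν _
  | succ n ih =>
    refine (h 0).bind hν (niceMap_argsCont (.evalArgs fun i => hμ i.succ)) fun v => ?_
    cases v
    case const r =>
      exact (ih (fun i => hμ i.succ) fun i => h i.succ).bind hν (niceMap_consDirac r)
        fun _ => .dirac hν _
    all_goals exact .zero

/-- With `ν` fixed, every construct is built from operations preserving `CommuteMeas`; `sample` is
the case that needs `hu`. -/
theorem CommuteMeas.evalStep (hn : NiceMap next) (hν : NiceMeasure ν)
    (hu : CommuteMeas SFPC.uniform ν) (h : ∀ t, CommuteMeas (next t) ν) (t : Tm ℝ) :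
    CommuteMeas (evalStep next t) ν := by
  have H := (niceMap_evalStep hn).apply
  induction t with
  | hole => exact .zero
  | var _ => exact .zero
  | const r => exact .dirac hν _
  | prim n f t ih =>
    refine (CommuteMeas.evalArgs hν (fun i => H (t i)) ih).bind hν (niceMap_primEval f) fun r => ?_
    unfold PrimFn.eval
    split_ifs
    exacts [.dirac hν _, .zero]
  | ifz t s₁ s₂ ih ih₁ ih₂ =>
    refine ih.bind hν (niceMap_ifzCont (H s₁) (H s₂)) fun v => ?_
    cases v
    case const r => simp only [onReal]; split_ifs <;> assumption
    all_goals exact .zero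
  | sample => exact hu.bind hν niceMap_constDirac fun _ => .dirac hν _
  | score t ih =>
    refine ih.bind hν niceMap_scoreCont fun v => ?_
    cases v
    case const r =>
      exact .smul (Nice.dirac (Plots.constant _)) (.dirac hν _) _
    all_goals exact .zero
  | unit => exact .dirac hν _
  | pair t s ih₁ ih₂ =>
    exact ih₁.bind hν (niceMap_pairCont (H s)) fun v =>
      ih₂.bind hν (niceMap_pairDirac v) fun _ => .dirac hν _
  | inj τ l t ih => exact ih.bind hν (niceMap_injDirac τ l) fun _ => .dirac hν _
  | roll τ t ih => exact ih.bind hν (niceMap_rollDirac τ) fun _ => .dirac hν _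
  | lam x τ t _ => exact .dirac hν _
  | app t s ih₁ ih₂ =>
    refine ih₁.bind hν (niceMap_appCont hn (H s)) fun v => ?_
    cases v
    case lam x τ b => exact ih₂.bind hν (niceMap_subst₁ hn b x) fun _ => h _
    all_goals exact .zero
  | umatch t s ih₁ ih₂ =>
    refine ih₁.bind hν (niceMap_umatchCont (H s)) fun v => ?_
    cases v
    case unit => exact ih₂
    all_goals exact .zero
  | pmatch t x y s ih₁ _ =>
    refine ih₁.bind hν (niceMap_pmatchCont hn x y s) fun v => ?_
    cases v
    case pair => exact h _
    all_goals exact .zero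
  | vmatch t L x s ih₁ _ =>
    refine ih₁.bind hν (niceMap_vmatchCont hn L x s) fun v => ?_
    cases v
    case inj =>
      dsimp only
      split_ifs
      exacts [h _, .zero]
    all_goals exact .zero
  | rmatch t x s ih₁ _ =>
    refine ih₁.bind hν (niceMap_rmatchCont hn x s) fun v => ?_
    cases v
    case roll => exact h _
    all_goals exact .zero

theorem CommuteMeas.eval_left (hν : NiceMeasure ν) (hu : CommuteMeas SFPC.uniform ν) (t : Tm ℝ) :
    CommuteMeas (eval t) ν := by
  refine .iSup (fun n => (niceMap_evalN n).apply t) hν (evalN_mono_apply t) fun n => ?_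
  induction n generalizing t with
  | zero => exact .zero
  | succ n ih => exact .evalStep (niceMap_evalN n) hν hu ih t

/-- Evaluations of two terms can be interchanged. -/
theorem CommuteMeas.eval (t s : Tm ℝ) : CommuteMeas (eval t) (eval s) :=
  .eval_left (niceMap_eval.apply s)
    -- The induction is run twice: against the uniform law it shows that `eval s` commutes with
    -- `uniform`, and by symmetry this is the base case for the run against `eval s`.
    (CommuteMeas.eval_left (.of_sFinite (B := ℝ) measurable_id _) .uniform s).symm t

end Commute

/-! ### Terms related by exchanging independent `let`s -/

/-- `SwapRel S t t'`: the free variables of `t` and `t'` are in `S`, and `t'` is obtained from `t`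
by exchanging some pairs of adjacent independent `let` bindings. -/
inductive SwapRel : Set ℕ → Tm ℝ → Tm ℝ → Prop
  -- The bound terms live over a smaller set `S₀`: a hole may occur where the context already binds
  -- `x₁` or `x₂`, so these can be asked to avoid `S₀` but not `S`.
  | swap {S S₀ : Set ℕ} {x₁ x₂ : ℕ} {τ₁ τ₂ : Ty 0} {a₁ a₁' a₂ a₂' a₃ a₃' : Tm ℝ} :
      x₁ ≠ x₂ → x₁ ∉ S₀ → x₂ ∉ S₀ → S₀ ⊆ S → SwapRel S₀ a₁ a₁' → SwapRel S₀ a₂ a₂' →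
      SwapRel (insert x₂ (insert x₁ S)) a₃ a₃' →
      SwapRel S (.letIn x₁ τ₁ a₁ (.letIn x₂ τ₂ a₂ a₃)) (.letIn x₂ τ₂ a₂' (.letIn x₁ τ₁ a₁' a₃'))
  | var {S : Set ℕ} {x : ℕ} : x ∈ S → SwapRel S (.var x) (.var x)
  | const {S : Set ℕ} (r : ℝ) : SwapRel S (.const r) (.const r)
  | prim {S : Set ℕ} {n : ℕ} (f : PrimFn n) {t t' : Fin n → Tm ℝ} :
      (∀ i, SwapRel S (t i) (t' i)) → SwapRel S (.prim n f t) (.prim n f t')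
  | ifz {S : Set ℕ} {t t' s₁ s₁' s₂ s₂' : Tm ℝ} : SwapRel S t t' → SwapRel S s₁ s₁' →
      SwapRel S s₂ s₂' → SwapRel S (.ifz t s₁ s₂) (.ifz t' s₁' s₂')
  | sample {S : Set ℕ} : SwapRel S .sample .sample
  | score {S : Set ℕ} {t t' : Tm ℝ} : SwapRel S t t' → SwapRel S (.score t) (.score t')
  | unit {S : Set ℕ} : SwapRel S .unit .unit
  | pair {S : Set ℕ} {t t' s s' : Tm ℝ} : SwapRel S t t' → SwapRel S s s' →
      SwapRel S (.pair t s) (.pair t' s')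
  | inj {S : Set ℕ} (τ : Ty 0) (l : ℕ) {t t' : Tm ℝ} : SwapRel S t t' →
      SwapRel S (.inj τ l t) (.inj τ l t')
  | roll {S : Set ℕ} (τ : Ty 0) {t t' : Tm ℝ} : SwapRel S t t' →
      SwapRel S (.roll τ t) (.roll τ t')
  | lam {S : Set ℕ} (x : ℕ) (τ : Ty 0) {t t' : Tm ℝ} : SwapRel (insert x S) t t' →
      SwapRel S (.lam x τ t) (.lam x τ t')
  | app {S : Set ℕ} {t t' s s' : Tm ℝ} : SwapRel S t t' → SwapRel S s s' →
      SwapRel S (.app t s) (.app t' s')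
  | umatch {S : Set ℕ} {t t' s s' : Tm ℝ} : SwapRel S t t' → SwapRel S s s' →
      SwapRel S (.umatch t s) (.umatch t' s')
  | pmatch {S : Set ℕ} (x y : ℕ) {t t' s s' : Tm ℝ} : SwapRel S t t' →
      SwapRel (insert y (insert x S)) s s' → SwapRel S (.pmatch t x y s) (.pmatch t' x y s')
  | vmatch {S : Set ℕ} (L : Finset ℕ) (x : {l // l ∈ L} → ℕ) {t t' : Tm ℝ}
      {s s' : {l // l ∈ L} → Tm ℝ} : SwapRel S t t' →
      (∀ l, SwapRel (insert (x l) S) (s l) (s' l)) →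
      SwapRel S (.vmatch t L x s) (.vmatch t' L x s')
  | rmatch {S : Set ℕ} (x : ℕ) {t t' s s' : Tm ℝ} : SwapRel S t t' →
      SwapRel (insert x S) s s' → SwapRel S (.rmatch t x s) (.rmatch t' x s')

theorem SwapRel.mono {S S' : Set ℕ} {t t' : Tm ℝ} (h : SwapRel S t t') (hS : S ⊆ S') :
    SwapRel S' t t' := by
  induction h generalizing S' with
  | swap hx h₁ h₂ h₀ r₁ r₂ _ _ _ ih₃ =>
    exact .swap hx h₁ h₂ (h₀.trans hS) r₁ r₂
      (ih₃ (Set.insert_subset_insert (Set.insert_subset_insert hS)))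
  | var hx => exact .var (hS hx)
  | const r => exact .const r
  | prim f _ ih => exact .prim f fun i => ih i hS
  | ifz _ _ _ ih₁ ih₂ ih₃ => exact .ifz (ih₁ hS) (ih₂ hS) (ih₃ hS)
  | sample => exact .sample
  | score _ ih => exact .score (ih hS)
  | unit => exact .unit
  | pair _ _ ih₁ ih₂ => exact .pair (ih₁ hS) (ih₂ hS)
  | inj τ l _ ih => exact .inj τ l (ih hS)
  | roll τ _ ih => exact .roll τ (ih hS)
  | lam x τ _ ih => exact .lam x τ (ih (Set.insert_subset_insert hS))
  | app _ _ ih₁ ih₂ => exact .app (ih₁ hS) (ih₂ hS)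
  | umatch _ _ ih₁ ih₂ => exact .umatch (ih₁ hS) (ih₂ hS)
  | pmatch x y _ _ ih₁ ih₂ =>
    exact .pmatch x y (ih₁ hS) (ih₂ (Set.insert_subset_insert (Set.insert_subset_insert hS)))
  | vmatch L x _ _ ih₁ ih₂ =>
    exact .vmatch L x (ih₁ hS) fun l => ih₂ l (Set.insert_subset_insert hS)
  | rmatch x _ _ ih₁ ih₂ => exact .rmatch x (ih₁ hS) (ih₂ (Set.insert_subset_insert hS))

theorem update_none_of_mem_insert {K : Type} {S : Set ℕ} {θ : ℕ → Option (Tm K)}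
    (hθ : ∀ x ∈ S, θ x = none) (y : ℕ) : ∀ x ∈ insert y S, Function.update θ y none x = none := by
  intro x hx
  by_cases e : x = y
  · subst e; simp
  · rw [Function.update_of_ne e]
    exact hθ x (hx.resolve_left e)

/-- For `S = ∅` this says that related terms are closed, hence fixed by every substitution. -/
theorem SwapRel.subst_eq {S : Set ℕ} {t t' : Tm ℝ} (h : SwapRel S t t')
    {θ : ℕ → Option (Tm ℝ)} (hθ : ∀ x ∈ S, θ x = none) : t.subst θ = t ∧ t'.subst θ = t' := by
  have U := @update_none_of_mem_insert ℝ
  induction h generalizing θ with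
  | @swap S S₀ x₁ x₂ _ _ _ _ _ _ _ _ hx h₁ h₂ h₀ _ _ _ ih₁ ih₂ ih₃ =>
    have h : ∀ x ∈ S₀, θ x = none := fun x hx => hθ x (h₀ hx)
    have hu : ∀ y, ∀ x ∈ S₀, Function.update θ y none x = none := fun y x hx =>
      U h y x (Set.mem_insert_of_mem y hx)
    have e := ih₃ (U (U hθ x₁) x₂)
    have e' := ih₃ (θ := Function.update (Function.update θ x₂ none) x₁ none)
      (Function.update_comm hx none none θ ▸ U (U hθ x₁) x₂)
    simp only [Tm.letIn, Tm.subst, e.1, e'.2, (ih₁ h).1, (ih₁ (hu x₂)).2, (ih₂ (hu x₁)).1,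
      (ih₂ h).2, and_self]
  | var hx => simp [Tm.subst, hθ _ hx]
  | const r => exact ⟨rfl, rfl⟩
  | prim f _ ih =>
    simp only [Tm.subst, fun i => (ih i hθ).1, fun i => (ih i hθ).2, and_self]
  | ifz _ _ _ ih₁ ih₂ ih₃ => simp only [Tm.subst, ih₁ hθ, ih₂ hθ, ih₃ hθ, and_self]
  | sample => exact ⟨rfl, rfl⟩
  | score _ ih => simp only [Tm.subst, ih hθ, and_self]
  | unit => exact ⟨rfl, rfl⟩
  | pair _ _ ih₁ ih₂ => simp only [Tm.subst, ih₁ hθ, ih₂ hθ, and_self]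
  | inj τ l _ ih => simp only [Tm.subst, ih hθ, and_self]
  | roll τ _ ih => simp only [Tm.subst, ih hθ, and_self]
  | lam x τ _ ih => simp only [Tm.subst, ih (U hθ x), and_self]
  | app _ _ ih₁ ih₂ => simp only [Tm.subst, ih₁ hθ, ih₂ hθ, and_self]
  | umatch _ _ ih₁ ih₂ => simp only [Tm.subst, ih₁ hθ, ih₂ hθ, and_self]
  | pmatch x y _ _ ih₁ ih₂ =>
    simp only [Tm.subst, ih₁ hθ, ih₂ (U (U hθ x) y), and_self]
  | vmatch L x _ _ ih₁ ih₂ =>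
    simp only [Tm.subst, ih₁ hθ, fun l => (ih₂ l (U hθ (x l))).1,
      fun l => (ih₂ l (U hθ (x l))).2, and_self]
  | rmatch x _ _ ih₁ ih₂ => simp only [Tm.subst, ih₁ hθ, ih₂ (U hθ x), and_self]

/-- Related substitutions: variables in `S` are mapped to related closed terms or left alone. -/
def SubstRel (S S' : Set ℕ) (θ θ' : ℕ → Option (Tm ℝ)) : Prop :=
  ∀ x ∈ S, (θ x = none ∧ θ' x = none ∧ x ∈ S') ∨
    ∃ v v', θ x = some v ∧ θ' x = some v' ∧ SwapRel ∅ v v'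

theorem SubstRel.update_none {S S' : Set ℕ} {θ θ' : ℕ → Option (Tm ℝ)} (h : SubstRel S S' θ θ')
    (y : ℕ) : SubstRel (insert y S) (insert y S') (Function.update θ y none)
      (Function.update θ' y none) := by
  intro x hx
  by_cases e : x = y
  · subst e; simp
  · simpa [Function.update_of_ne e, e] using h x (hx.resolve_left e)

theorem SwapRel.subst {S S' : Set ℕ} {t t' : Tm ℝ} (h : SwapRel S t t')
    {θ θ' : ℕ → Option (Tm ℝ)} (hθ : SubstRel S S' θ θ') :
    SwapRel S' (t.subst θ) (t'.subst θ') := by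
  induction h generalizing S' θ θ' with
  | @swap S S₀ x₁ x₂ _ _ _ _ _ _ _ _ hx h₁ h₂ h₀ _ _ _ ih₁ ih₂ ih₃ =>
    have hS₀ : ∀ x ∈ S₀, x ≠ x₁ ∧ x ≠ x₂ := fun x hx =>
      ⟨fun e => h₁ (e ▸ hx), fun e => h₂ (e ▸ hx)⟩
    -- Variables of `S₀` that survive differ from `x₁` and `x₂`, and substituted terms are closed,
    -- so `S' \ {x₁, x₂}` can serve as the new small set.
    have h : SubstRel S₀ (S' \ {x₁, x₂}) θ θ' := by
      intro x hx
      rcases hθ x (h₀ hx) with ⟨h, h', hS'⟩ | h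
      · exact .inl ⟨h, h', hS', by simp [hS₀ x hx]⟩
      · exact .inr h
    -- On the left `a₂` lies under the binder `x₁`, on the right `a₁'` lies under `x₂`. Erasing that
    -- variable from the substitution changes nothing on `S₀`.
    have hl : SubstRel S₀ (S' \ {x₁, x₂}) (Function.update θ x₁ none) θ' := fun x hx => by
      rw [Function.update_of_ne (hS₀ x hx).1]; exact h x hx
    have hr : SubstRel S₀ (S' \ {x₁, x₂}) θ (Function.update θ' x₂ none) := fun x hx => by
      rw [Function.update_of_ne (hS₀ x hx).2]; exact h x hx
    refine .swap (S₀ := S' \ {x₁, x₂}) hx (by simp) (by simp) Set.sdiff_subset (ih₁ hr) (ih₂ hl) ?_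
    rw [Function.update_comm hx.symm none none θ']
    exact ih₃ ((hθ.update_none x₁).update_none x₂)
  | var hx =>
    rcases hθ _ hx with ⟨h, h', hS'⟩ | ⟨v, v', h, h', hv⟩
    · simpa [Tm.subst, h, h'] using SwapRel.var hS'
    · simpa [Tm.subst, h, h'] using hv.mono (Set.empty_subset S')
  | const r => exact .const r
  | prim f _ ih => exact .prim f fun i => ih i hθ
  | ifz _ _ _ ih₁ ih₂ ih₃ => exact .ifz (ih₁ hθ) (ih₂ hθ) (ih₃ hθ)
  | sample => exact .sample
  | score _ ih => exact .score (ih hθ)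
  | unit => exact .unit
  | pair _ _ ih₁ ih₂ => exact .pair (ih₁ hθ) (ih₂ hθ)
  | inj τ l _ ih => exact .inj τ l (ih hθ)
  | roll τ _ ih => exact .roll τ (ih hθ)
  | lam x τ _ ih => exact .lam x τ (ih (hθ.update_none x))
  | app _ _ ih₁ ih₂ => exact .app (ih₁ hθ) (ih₂ hθ)
  | umatch _ _ ih₁ ih₂ => exact .umatch (ih₁ hθ) (ih₂ hθ)
  | pmatch x y _ _ ih₁ ih₂ =>
    exact .pmatch x y (ih₁ hθ) (ih₂ ((hθ.update_none x).update_none y))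
  | vmatch L x _ _ ih₁ ih₂ => exact .vmatch L x (ih₁ hθ) fun l => ih₂ l (hθ.update_none (x l))
  | rmatch x _ _ ih₁ ih₂ => exact .rmatch x (ih₁ hθ) (ih₂ (hθ.update_none x))

theorem SwapRel.subst₂ {x y : ℕ} {t t' v v' w w' : Tm ℝ}
    (h : SwapRel (insert y (insert x ∅)) t t') (hv : SwapRel ∅ v v') (hw : SwapRel ∅ w w') :
    SwapRel ∅ (t.subst₂ x v y w) (t'.subst₂ x v' y w') := by
  refine h.subst fun z hz => .inr ?_
  by_cases e : z = y
  · subst e; exact ⟨w, w', by simp, by simp, hw⟩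
  · obtain rfl : z = x := by simpa [e] using hz
    exact ⟨v, v', by simp [Function.update_of_ne e], by simp [Function.update_of_ne e], hv⟩

theorem SwapRel.subst₁ {x : ℕ} {t t' v v' : Tm ℝ} (h : SwapRel (insert x ∅) t t')
    (hv : SwapRel ∅ v v') : SwapRel ∅ (t.subst₁ x v) (t'.subst₁ x v') := by
  have h' : SwapRel (insert x (insert x ∅)) t t' := h.mono (Set.subset_insert _ _)
  simpa [Tm.subst₁, Tm.subst₂] using h'.subst₂ hv hv

/-- The terms supplied by `θ` are closed, so the second substitution passes through them and acts
only where `θ` is undefined. -/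
theorem Tm.subst_subst {K : Type} (t : Tm K) {θ θ' : ℕ → Option (Tm K)}
    (hθ : ∀ x v, θ x = some v → ∀ θ'', v.subst θ'' = v) :
    (t.subst θ).subst θ' = t.subst fun x => (θ x).or (θ' x) := by
  have upd : ∀ (θ θ' : ℕ → Option (Tm K)) (y : ℕ),
      (fun x => (Function.update θ y none x).or (Function.update θ' y none x)) =
        Function.update (fun x => (θ x).or (θ' x)) y none := by
    intro θ θ' y
    funext x
    by_cases e : x = y
    · subst e; simp
    · simp [Function.update_of_ne e]
  have hupd : ∀ {θ : ℕ → Option (Tm K)}, (∀ x v, θ x = some v → ∀ θ'', v.subst θ'' = v) →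
      ∀ y, ∀ x v, Function.update θ y none x = some v → ∀ θ'', v.subst θ'' = v := by
    intro θ hθ y x v h
    by_cases e : x = y
    · subst e; simp at h
    · rw [Function.update_of_ne e] at h
      exact hθ x v h
  induction t generalizing θ θ' with
  | var x =>
    cases h : θ x with
    | none => simp [Tm.subst, h]
    | some v => simp [Tm.subst, h, hθ x v h]
  | lam x τ t ih => simp only [Tm.subst, ih (hupd hθ x), upd]
  | pmatch t x y s ih₁ ih₂ => simp only [Tm.subst, ih₁ hθ, ih₂ (hupd (hupd hθ x) y), upd]
  | vmatch t L x s ih₁ ih₂ =>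
    simp only [Tm.subst, ih₁ hθ,
      fun l => ih₂ l (hupd hθ (x l)) (θ' := Function.update θ' (x l) none), upd]
  | rmatch t x s ih₁ ih₂ => simp only [Tm.subst, ih₁ hθ, ih₂ (hupd hθ x), upd]
  | prim n f t ih => simp only [Tm.subst, fun i => ih i hθ (θ' := θ')]
  | ifz _ _ _ ih₁ ih₂ ih₃ => simp only [Tm.subst, ih₁ hθ, ih₂ hθ, ih₃ hθ]
  | score _ ih => simp only [Tm.subst, ih hθ]
  | pair _ _ ih₁ ih₂ => simp only [Tm.subst, ih₁ hθ, ih₂ hθ]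
  | inj _ _ _ ih => simp only [Tm.subst, ih hθ]
  | roll _ _ ih => simp only [Tm.subst, ih hθ]
  | app _ _ ih₁ ih₂ => simp only [Tm.subst, ih₁ hθ, ih₂ hθ]
  | umatch _ _ ih₁ ih₂ => simp only [Tm.subst, ih₁ hθ, ih₂ hθ]
  | _ => rfl

theorem Tm.subst₁_subst₁ {K : Type} (t : Tm K) {x y : ℕ} (hxy : x ≠ y) {v : Tm K} (w : Tm K)
    (hv : ∀ θ, v.subst θ = v) : (t.subst₁ x v).subst₁ y w = t.subst₂ x v y w := by
  rw [Tm.subst₁, Tm.subst₁, Tm.subst_subst, Tm.subst₂]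
  · congr 1
    funext z
    by_cases e : z = y
    · subst e; simp [Function.update_of_ne hxy.symm]
    · by_cases e' : z = x
      · subst e'; simp [Function.update_of_ne e]
      · simp [Function.update_of_ne e, Function.update_of_ne e']
  · intro z u h
    by_cases e : z = x
    · subst e; simp at h; exact h ▸ hv
    · simp [Function.update_of_ne e] at h

theorem Tm.subst₂_comm {K : Type} (t : Tm K) {x y : ℕ} (hxy : x ≠ y) (v w : Tm K) :
    t.subst₂ x v y w = t.subst₂ y w x v := by
  rw [Tm.subst₂, Tm.subst₂, Function.update_comm hxy]

theorem Tm.letIn_subst₁ {K : Type} {x y : ℕ} (hxy : x ≠ y) (τ : Ty 0) {a : Tm K} (b w : Tm K)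
    (ha : ∀ θ, a.subst θ = a) :
    (Tm.letIn x τ a b).subst₁ y w = .letIn x τ a (b.subst₁ y w) := by
  simp only [Tm.letIn, Tm.subst₁, Tm.subst, ha]
  rw [Function.update_comm hxy.symm, Function.update_eq_self x (fun _ => none)]

/-! ### Lifting the relation to measures -/

section Lift

variable {B B' : Type} [MeasurableSpace B] [MeasurableSpace B']

/-- Lifting of a relation on points to measures, tested on pairs of measurable functions. -/
def Lift (R : B → B → Prop) (μ μ' : Measure B) : Prop :=
  ∀ g g' : B → ℝ≥0∞, Measurable g → Measurable g' → (∀ b b', R b b' → g b ≤ g' b') →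
    ∫⁻ b, g b ∂μ ≤ ∫⁻ b, g' b ∂μ'

theorem Lift.zero {R : B → B → Prop} {μ : Measure B} : Lift R 0 μ := by
  intro g g' _ _ _; simp

theorem Lift.dirac {R : B → B → Prop} {b b' : B} (h : R b b') :
    Lift R (Measure.dirac b) (Measure.dirac b') := by
  intro g g' hg hg' H
  rw [lintegral_dirac' _ hg, lintegral_dirac' _ hg']
  exact H b b' h

theorem Lift.smul {R : B → B → Prop} {μ μ' : Measure B} (h : Lift R μ μ') (c : ℝ≥0∞) :
    Lift R (c • μ) (c • μ') := by
  intro g g' hg hg' H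
  simp only [lintegral_smul_measure, smul_eq_mul]
  exact mul_le_mul_right (h g g' hg hg' H) c

theorem Lift.eq (μ : Measure B) : Lift Eq μ μ :=
  fun _ _ _ _ H => lintegral_mono fun b => H b b rfl

/-- Integrating a related pair of test functions against related kernels yields a related pair
again. Defining the lifting by test functions avoids constructing couplings. -/
theorem Lift.bind {R : B → B → Prop} {R' : B' → B' → Prop} {μ μ' : Measure B}
    {k k' : B → Measure B'} (h : Lift R μ μ') (hk : Measurable k) (hk' : Measurable k')
    (H : ∀ b b', R b b' → Lift R' (k b) (k' b')) : Lift R' (μ.bind k) (μ'.bind k') := by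
  intro g g' hg hg' hgg'
  rw [Measure.lintegral_bind hk.aemeasurable hg.aemeasurable,
    Measure.lintegral_bind hk'.aemeasurable hg'.aemeasurable]
  exact h _ _ ((Measure.measurable_lintegral hg).comp hk)
    ((Measure.measurable_lintegral hg').comp hk') fun b b' hb => H b b' hb g g' hg hg' hgg'

end Lift

/-- Related constants are equal, so tuples of arguments are compared along equality. -/
theorem Lift.evalArgs {n : ℕ} {μ μ' : Fin n → Measure (Tm ℝ)} (hμ : ∀ i, NiceMeasure (μ i))
    (hμ' : ∀ i, NiceMeasure (μ' i)) (h : ∀ i, Lift (SwapRel ∅) (μ i) (μ' i)) :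
    Lift Eq (evalArgs n μ) (evalArgs n μ') := by
  induction n with
  | zero => exact .eq _
  | succ n ih =>
    refine (h 0).bind (niceMap_argsCont (.evalArgs fun i => hμ i.succ)).measurable
      (niceMap_argsCont (.evalArgs fun i => hμ' i.succ)).measurable fun v v' hv => ?_
    cases hv
    case const r =>
      exact (ih (fun i => hμ i.succ) (fun i => hμ' i.succ) fun i => h i.succ).bind
        (niceMap_consDirac r).measurable (niceMap_consDirac r).measurable
        fun _ _ e => e ▸ .eq _
    all_goals exact .zero

theorem evalStep_letIn {next : Tm ℝ → Measure (Tm ℝ)} (hn : NiceMap next) (x : ℕ) (τ : Ty 0)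
    (t s : Tm ℝ) : evalStep next (.letIn x τ t s) =
      (evalStep next t).bind fun w => next (s.subst₁ x w) := by
  rw [Tm.letIn, evalStep_app, evalStep, Measure.dirac_bind
    (niceMap_appCont hn ((niceMap_evalStep hn).apply t)).measurable]
  rfl

theorem eval_letIn (x : ℕ) (τ : Ty 0) (t s : Tm ℝ) :
    eval (.letIn x τ t s) = (eval t).bind fun w => eval (s.subst₁ x w) := by
  rw [eval_eq_evalStep, evalStep_letIn niceMap_eval, ← eval_eq_evalStep]

theorem niceMap_bind_subst₁_subst₁ (a t : Tm ℝ) (x y : ℕ) :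
    NiceMap fun v => (eval a).bind fun w => eval ((t.subst₁ x w).subst₁ y v) :=
  fun _ _ _ hf => (niceMap_eval.apply a).nice.bind fun _ _ _ _ ha hg =>
    niceMap_eval _ _ (((TermFamily.constant t).subst₁ x hg).subst₁ y (hf.comp ha))

/-- Independent evaluations that feed a common body can be exchanged. -/
theorem bind_eval_comm (a₁ a₂ t : Tm ℝ) (x₁ x₂ : ℕ) :
    ((eval a₂).bind fun w => (eval a₁).bind fun v => eval ((t.subst₁ x₂ w).subst₁ x₁ v)) =
      (eval a₁).bind fun v => (eval a₂).bind fun w => eval ((t.subst₁ x₂ w).subst₁ x₁ v) := by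
  have h₁ : NiceMap fun w => (eval a₁).bind fun v => eval ((t.subst₁ x₂ w).subst₁ x₁ v) :=
    fun _ _ _ hf => (niceMap_eval.apply a₁).nice.bind fun _ _ _ _ ha hg =>
      niceMap_eval _ _ (((TermFamily.constant t).subst₁ x₂ (hf.comp ha)).subst₁ x₁ hg)
  have h₂ := niceMap_bind_subst₁_subst₁ a₂ t x₂ x₁
  have h₃ : ∀ w, Measurable fun v => eval ((t.subst₁ x₂ w).subst₁ x₁ v) := fun w =>
    (niceMap_subst₁ niceMap_eval _ x₁).measurable
  have h₄ : ∀ v, NiceMap fun w => eval ((t.subst₁ x₂ w).subst₁ x₁ v) := fun v _ _ _ hf =>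
    niceMap_eval _ _ (((TermFamily.constant t).subst₁ x₂ hf).subst₁ x₁ (.constant v))
  ext A hA
  rw [Measure.bind_apply hA h₁.measurable.aemeasurable,
    Measure.bind_apply hA h₂.measurable.aemeasurable]
  simp only [Measure.bind_apply hA (h₃ _).aemeasurable,
    Measure.bind_apply hA (h₄ _).measurable.aemeasurable]
  refine CommuteMeas.eval a₂ a₁ (fun w v => eval ((t.subst₁ x₂ w).subst₁ x₁ v) A)
    fun Z _ f f' hf hf' => (Measure.measurable_coe hA).comp (Nice.measurable ?_)
  exact niceMap_eval _ _ (((TermFamily.constant t).subst₁ x₂ hf).subst₁ x₁ hf')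

/-- Evaluation respects the exchange of independent `let`s. -/
theorem SwapRel.lift_evalN (n : ℕ) {t t' : Tm ℝ} (h : SwapRel ∅ t t') :
    Lift (SwapRel ∅) (evalN n t) (eval t') := by
  -- Strong induction is needed because the exchanged pair of bindings consumes two levels.
  induction n using Nat.strong_induction_on generalizing t t' with
  | _ n IH =>
  cases n with
  | zero => exact .zero
  | succ n =>
  have hn := niceMap_evalN n
  have he := niceMap_eval
  have H := (niceMap_evalStep hn).apply
  have H' := (niceMap_evalStep he).apply
  rw [eval_eq_evalStep]
  change Lift _ (evalStep (evalN n) t) _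
  have hN : ∀ {u u' : Tm ℝ}, SwapRel ∅ u u' → Lift (SwapRel ∅) (evalN n u) (eval u') :=
    fun hu => IH n n.lt_succ_self hu
  -- An inner induction on the derivation, at fixed level, handles immediate subterms; `hN` handles
  -- substituted bodies, one level down.
  generalize hS : (∅ : Set ℕ) = S at h
  induction h with
  | @swap S S₀ x₁ x₂ τ₁ τ₂ a₁ a₁' a₂ a₂' a₃ a₃' hx h₁ h₂ h₀ r₁ r₂ r₃ ih₁ _ _ =>
    subst hS
    obtain rfl : S₀ = ∅ := Set.subset_empty_iff.1 h₀
    have c₁ : ∀ θ, a₁'.subst θ = a₁' := fun θ => (r₁.subst_eq fun _ h => h.elim).2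
    have c₂ : ∀ θ, a₂.subst θ = a₂ := fun θ => (r₂.subst_eq fun _ h => h.elim).1
    rw [evalStep_letIn hn, ← eval_eq_evalStep, eval_letIn]
    simp only [Tm.letIn_subst₁ hx τ₁ a₃' _ c₁, Tm.letIn_subst₁ hx.symm τ₂ a₃ _ c₂, eval_letIn]
    -- After the exchange the right-hand side also evaluates `a₁'` before `a₂'`, and the two sides
    -- can be compared factor by factor.
    rw [bind_eval_comm]
    have ih := ih₁ rfl
    rw [← eval_eq_evalStep] at ih
    refine ih.bind ?_ (niceMap_bind_subst₁_subst₁ a₂' a₃' x₂ x₁).measurable fun v v' hv => ?_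
    · simpa only [Tm.letIn_subst₁ hx.symm τ₂ a₃ _ c₂] using
        (niceMap_subst₁ hn (.letIn x₂ τ₂ a₂ a₃) x₁).measurable
    · cases n with
      -- The left program has no level left to evaluate its inner binding.
      | zero => exact .zero
      | succ m =>
        change Lift _ (evalStep (evalN m) _) _
        rw [evalStep_letIn (niceMap_evalN m)]
        refine (hN r₂).bind (niceMap_subst₁ (niceMap_evalN m) _ x₂).measurable
          (NiceMap.measurable fun _ _ _ hf => niceMap_eval _ _
            (((TermFamily.constant a₃').subst₁ x₂ hf).subst₁ x₁ (.constant v')))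
          fun w w' hw => IH m (by omega) ?_
        -- The two sides substitute in opposite orders; as the values are closed, both agree with
        -- the simultaneous substitution.
        rw [Tm.subst₁_subst₁ _ hx _ fun θ => (hv.subst_eq fun _ h => h.elim).1,
          Tm.subst₁_subst₁ _ hx.symm _ fun θ => (hw.subst_eq fun _ h => h.elim).2,
          Tm.subst₂_comm _ hx.symm]
        exact r₃.subst₂ hv hw
  | var hx => exact .zero
  | const r => exact .dirac (.const r)
  | @prim S m f t t' _ ih =>
    subst hS
    exact (Lift.evalArgs (fun i => H (t i)) (fun i => H' (t' i)) fun i => ih i rfl).bind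
      (niceMap_primEval f).measurable (niceMap_primEval f).measurable
      fun r _ e => e ▸ (by
        unfold PrimFn.eval
        split_ifs
        exacts [.dirac (.const _), .zero])
  | ifz _ _ _ ih ih₁ ih₂ =>
    refine (ih hS).bind (niceMap_ifzCont (H _) (H _)).measurable
      (niceMap_ifzCont (H' _) (H' _)).measurable fun v v' hv => ?_
    cases hv
    case const r =>
      simp only [onReal]
      split_ifs
      exacts [ih₁ hS, ih₂ hS]
    all_goals exact .zero
  | sample =>
    exact (Lift.eq uniform).bind niceMap_constDirac.measurable niceMap_constDirac.measurable
      fun r _ e => e ▸ .dirac (.const r)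
  | score _ ih =>
    refine (ih hS).bind niceMap_scoreCont.measurable niceMap_scoreCont.measurable
      fun v v' hv => ?_
    cases hv
    case const r => exact (Lift.dirac .unit).smul _
    all_goals exact .zero
  | unit => exact .dirac .unit
  | pair _ _ ih₁ ih₂ =>
    exact (ih₁ hS).bind (niceMap_pairCont (H _)).measurable (niceMap_pairCont (H' _)).measurable
      fun v v' hv => (ih₂ hS).bind (niceMap_pairDirac v).measurable
        (niceMap_pairDirac v').measurable fun w w' hw => .dirac (hv.pair hw)
  | inj τ l _ ih =>
    exact (ih hS).bind (niceMap_injDirac τ l).measurable (niceMap_injDirac τ l).measurable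
      fun v v' hv => .dirac (hv.inj τ l)
  | roll τ _ ih =>
    exact (ih hS).bind (niceMap_rollDirac τ).measurable (niceMap_rollDirac τ).measurable
      fun v v' hv => .dirac (hv.roll τ)
  | lam x τ h _ => exact .dirac (hS ▸ h.lam x τ)
  | app _ _ ih₁ ih₂ =>
    subst hS
    refine (ih₁ rfl).bind (niceMap_appCont hn (H _)).measurable
      (niceMap_appCont he (H' _)).measurable fun v v' hv => ?_
    cases hv
    case lam x τ b b' hb =>
      exact (ih₂ rfl).bind (niceMap_subst₁ hn b x).measurable (niceMap_subst₁ he b' x).measurable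
        fun w w' hw => hN (hb.subst₁ hw)
    all_goals exact .zero
  | umatch _ _ ih₁ ih₂ =>
    refine (ih₁ hS).bind (niceMap_umatchCont (H _)).measurable
      (niceMap_umatchCont (H' _)).measurable fun v v' hv => ?_
    cases hv
    case unit => exact ih₂ hS
    all_goals exact .zero
  | pmatch x y _ hs ih₁ _ =>
    subst hS
    refine (ih₁ rfl).bind (niceMap_pmatchCont hn x y _).measurable
      (niceMap_pmatchCont he x y _).measurable fun v v' hv => ?_
    cases hv
    case pair h₁ h₂ => exact hN (hs.subst₂ h₁ h₂)
    all_goals exact .zero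
  | vmatch L x _ hs ih₁ _ =>
    subst hS
    refine (ih₁ rfl).bind (niceMap_vmatchCont hn L x _).measurable
      (niceMap_vmatchCont he L x _).measurable fun v v' hv => ?_
    cases hv
    case inj τ l v v' h =>
      dsimp only
      split_ifs with hl
      exacts [hN ((hs ⟨l, hl⟩).subst₁ h), .zero]
    all_goals exact .zero
  | rmatch x _ hs ih₁ _ =>
    subst hS
    refine (ih₁ rfl).bind (niceMap_rmatchCont hn x _).measurable
      (niceMap_rmatchCont he x _).measurable fun v v' hv => ?_
    cases hv
    case roll h => exact hN (hs.subst₁ h)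
    all_goals exact .zero

theorem SwapRel.lift_eval {t t' : Tm ℝ} (h : SwapRel ∅ t t') :
    Lift (SwapRel ∅) (eval t) (eval t') := by
  intro g g' hg hg' H
  rw [eval, lintegral_iSup_measure (evalN_mono_apply t) hg]
  exact iSup_le fun n => h.lift_evalN n g g' hg hg' H

/-! ### Typing -/

/-- The domain of a variable context. -/
def Ctx.dom (Γ : Ctx) : Set ℕ := {x | Γ x ≠ none}

theorem Ctx.dom_extend (Γ : Ctx) (x : ℕ) (τ : Ty 0) : (Γ.extend x τ).dom = insert x Γ.dom := by
  ext y
  by_cases e : y = x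
  · subst e; simp [Ctx.dom, Ctx.extend]
  · simp [Ctx.dom, Ctx.extend, e]

theorem Ctx.extend_comm (Γ : Ctx) {x y : ℕ} (hxy : x ≠ y) (σ τ : Ty 0) :
    (Γ.extend x σ).extend y τ = (Γ.extend y τ).extend x σ :=
  Function.update_comm hxy _ _ _

theorem Ctx.Le.dom_subset {Γ Γ' : Ctx} (h : Γ.Le Γ') : Γ.dom ⊆ Γ'.dom := by
  intro x hx
  obtain ⟨τ, hτ⟩ := Option.ne_none_iff_exists'.1 hx
  exact Option.ne_none_iff_exists'.2 ⟨τ, h x τ hτ⟩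

theorem Ctx.Le.extend {Γ Γ' : Ctx} (h : Γ.Le Γ') (x : ℕ) (τ : Ty 0) :
    (Γ.extend x τ).Le (Γ'.extend x τ) := by
  intro y σ hy
  by_cases e : y = x
  · subst e; simpa [Ctx.extend] using hy
  · rw [Ctx.extend, Function.update_of_ne e] at hy ⊢
    exact h y σ hy

theorem Ctx.le_extend {Γ : Ctx} {x : ℕ} (h : Γ x = none) (τ : Ty 0) : Γ.Le (Γ.extend x τ) := by
  intro y σ hy
  have e : y ≠ x := by rintro rfl; simp [h] at hy
  rwa [Ctx.extend, Function.update_of_ne e]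

theorem HasType.weaken {K : Type} {H : Option (Ctx × Ty 0)} {Γ Γ' : Ctx} {t : Tm K} {τ : Ty 0}
    (h : HasType H Γ t τ) (hΓ : Γ.Le Γ') : HasType H Γ' t τ := by
  induction h generalizing Γ' with
  | hole hH hle => exact .hole hH fun x τ hx => hΓ x τ (hle x τ hx)
  | var hx => exact .var (hΓ _ _ hx)
  | const r => exact .const r
  | prim f _ ih => exact .prim f fun i => ih i hΓ
  | ifz _ _ _ ih₁ ih₂ ih₃ => exact .ifz (ih₁ hΓ) (ih₂ hΓ) (ih₃ hΓ)
  | sample => exact .sample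
  | score _ ih => exact .score (ih hΓ)
  | unit => exact .unit
  | pair _ _ ih₁ ih₂ => exact .pair (ih₁ hΓ) (ih₂ hΓ)
  | inj l _ ih => exact .inj l (ih hΓ)
  | roll _ ih => exact .roll (ih hΓ)
  | lam _ ih => exact .lam (ih (hΓ.extend _ _))
  | app _ _ ih₁ ih₂ => exact .app (ih₁ hΓ) (ih₂ hΓ)
  | umatch _ _ ih₁ ih₂ => exact .umatch (ih₁ hΓ) (ih₂ hΓ)
  | pmatch hxy _ _ ih₁ ih₂ => exact .pmatch hxy (ih₁ hΓ) (ih₂ ((hΓ.extend _ _).extend _ _))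
  | vmatch _ _ ih₁ ih₂ => exact .vmatch (ih₁ hΓ) fun l => ih₂ l (hΓ.extend _ _)
  | rmatch _ _ ih₁ ih₂ => exact .rmatch (ih₁ hΓ) (ih₂ (hΓ.extend _ _))

/-- The typing derivation of the context is used only to bound free variables; no type preservation
is involved. -/
theorem HasType.swapRel_plug {H : Option (Ctx × Ty 0)} {Γ : Ctx} {C t t' : Tm ℝ} {τ : Ty 0}
    (h : HasType H Γ C τ) (ht : ∀ Γ₀ τ₀, H = some (Γ₀, τ₀) → SwapRel Γ₀.dom t t') :
    SwapRel Γ.dom (C.plug t) (C.plug t') := by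
  induction h with
  | hole hH hle => exact (ht _ _ hH).mono hle.dom_subset
  | var hx => exact .var (by simp [Ctx.dom, hx])
  | const r => exact .const r
  | prim f _ ih => exact .prim f ih
  | ifz _ _ _ ih₁ ih₂ ih₃ => exact .ifz ih₁ ih₂ ih₃
  | sample => exact .sample
  | score _ ih => exact .score ih
  | unit => exact .unit
  | pair _ _ ih₁ ih₂ => exact .pair ih₁ ih₂
  | inj l _ ih => exact .inj _ l ih
  | roll _ ih => exact .roll _ ih
  | lam _ ih => exact .lam _ _ (Ctx.dom_extend _ _ _ ▸ ih)
  | app _ _ ih₁ ih₂ => exact .app ih₁ ih₂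
  | umatch _ _ ih₁ ih₂ => exact .umatch ih₁ ih₂
  | pmatch _ _ _ ih₁ ih₂ =>
    rw [Ctx.dom_extend, Ctx.dom_extend] at ih₂
    exact .pmatch _ _ ih₁ ih₂
  | vmatch _ _ ih₁ ih₂ => exact .vmatch _ _ ih₁ fun l => Ctx.dom_extend _ _ _ ▸ ih₂ l
  | rmatch _ _ ih₁ ih₂ => exact .rmatch _ ih₁ (Ctx.dom_extend _ _ _ ▸ ih₂)

theorem HasType.plug_eq_self {K : Type} {Γ : Ctx} {t s : Tm K} {τ : Ty 0}
    (h : HasType none Γ t τ) : t.plug s = t := by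
  induction h with
  | hole hH _ => simp at hH
  | _ => simp_all [Tm.plug]

theorem HasType.swapRel_refl {Γ : Ctx} {t : Tm ℝ} {τ : Ty 0} (h : HasType none Γ t τ) :
    SwapRel Γ.dom t t := by
  -- An ordinary term has no typable hole, so `.unit` is a dummy filler.
  simpa only [h.plug_eq_self] using
    h.swapRel_plug (t := .unit) (t' := .unit) fun _ _ hH => by simp at hH

theorem hasType_letIn {H : Option (Ctx × Ty 0)} {Γ : Ctx} {x : ℕ} {σ τ : Ty 0} {t s : Tm ℝ}
    (ht : HasType H Γ t σ) (hs : HasType H (Γ.extend x σ) s τ) :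
    HasType H Γ (.letIn x σ t s) τ :=
  .app (.lam hs) ht

theorem ctxPreorder_of_swapRel {Γ : Ctx} {τ : Ty 0} {t s : Tm ℝ} (ht : t ∈ Expr Γ τ)
    (hs : s ∈ Expr Γ τ) (h : SwapRel Γ.dom t s) : CtxPreorder Γ τ t s := by
  refine ⟨ht, hs, fun C hC A hA hsub => ?_⟩
  have hr : SwapRel Ctx.empty.dom (C.plug t) (C.plug s) := hC.swapRel_plug fun Γ₀ τ₀ e => by
    simp only [Option.some.injEq, Prod.mk.injEq] at e
    exact e.1 ▸ h
  have he : Ctx.empty.dom = ∅ := by ext x; simp [Ctx.dom, Ctx.empty]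
  rw [he] at hr
  have hm : Measurable (A.indicator (1 : Tm ℝ → ℝ≥0∞)) := measurable_one.indicator hA
  rw [← lintegral_indicator_one hA, ← lintegral_indicator_one hA]
  refine hr.lift_eval _ _ hm hm fun v v' hv => ?_
  by_cases hvA : v ∈ A
  · obtain ⟨hval, hty⟩ := hsub hvA
    -- A closed value of type `Real` is a constant, and a constant is related only to itself; hence
    -- the indicator of `A` is a valid test function on both sides.
    cases hty with
    | const r => cases hv; exact le_rfl
    | var hx => simp [Ctx.empty] at hx
    | _ => cases hval
  · simp [hvA]

theorem ctxPreorder_letIn_comm {Γ : Ctx} {x₁ x₂ : ℕ} (hx : x₁ ≠ x₂) (hx₁ : Γ x₁ = none)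
    (hx₂ : Γ x₂ = none) {τ₁ τ₂ τ₃ : Ty 0} {t₁ t₂ t₃ : Tm ℝ} (ht₁ : t₁ ∈ Expr Γ τ₁)
    (ht₂ : t₂ ∈ Expr Γ τ₂) (ht₃ : t₃ ∈ Expr ((Γ.extend x₁ τ₁).extend x₂ τ₂) τ₃) :
    CtxPreorder Γ τ₃ (.letIn x₁ τ₁ t₁ (.letIn x₂ τ₂ t₂ t₃))
      (.letIn x₂ τ₂ t₂ (.letIn x₁ τ₁ t₁ t₃)) := by
  refine ctxPreorder_of_swapRel
    (hasType_letIn ht₁ (hasType_letIn (HasType.weaken ht₂ (Ctx.le_extend hx₁ _)) ht₃))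
    (hasType_letIn ht₂ (hasType_letIn (HasType.weaken ht₁ (Ctx.le_extend hx₂ _))
      (Ctx.extend_comm Γ hx _ _ ▸ ht₃)))
    -- At the top level the small set is all of `Γ.dom`; it becomes a proper subset only once the
    -- terms are plugged under further binders.
    (.swap hx (by simp [Ctx.dom, hx₁]) (by simp [Ctx.dom, hx₂]) subset_rfl
      (HasType.swapRel_refl ht₁) (HasType.swapRel_refl ht₂) ?_)
  simpa only [Ctx.dom_extend] using HasType.swapRel_refl ht₃

end SFPC

theorem mainTheorem2 (Γ : SFPC.Ctx) (x₁ x₂ : ℕ) (hx : x₁ ≠ x₂)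
    (hx₁ : Γ x₁ = none) (hx₂ : Γ x₂ = none)
    (τ₁ τ₂ τ₃ : SFPC.Ty 0) (t₁ t₂ t₃ : SFPC.Tm ℝ)
    (ht₁ : t₁ ∈ SFPC.Expr Γ τ₁) (ht₂ : t₂ ∈ SFPC.Expr Γ τ₂)
    (ht₃ : t₃ ∈ SFPC.Expr ((Γ.extend x₁ τ₁).extend x₂ τ₂) τ₃) :
    SFPC.CtxEquiv Γ τ₃
      (.letIn x₁ τ₁ t₁ (.letIn x₂ τ₂ t₂ t₃))
      (.letIn x₂ τ₂ t₂ (.letIn x₁ τ₁ t₁ t₃)) := by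
  refine ⟨SFPC.ctxPreorder_letIn_comm hx hx₁ hx₂ ht₁ ht₂ ht₃,
    SFPC.ctxPreorder_letIn_comm hx.symm hx₂ hx₁ ht₂ ht₁ ?_⟩
  rwa [SFPC.Ctx.extend_comm Γ hx.symm]
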